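/- A (right) Leibniz algebra over $\mathbb C$ is a complex vector space with a bilinear bracket satisfying $[x,[y,z]]=[[x,y],z]-[[x,z],y]$. It is solvable if its derived series $L^{[1]}=L$, $L^{[s+1]}=[L^{[s]},L^{[s]}]$ reaches $0$, and nilpotent if $L^1=L$, $L^{k+1}=[L^k,L]$ reaches $0$. The nilradical is the largest nilpotent two-sided ideal. Consider the following algebras with basis $e_1,e_2,e_3,x$ (products of basis vectors that are not written are $0$; parameters are arbitrary complex numbers unless restricted): - $L_{20}(\mu_2,\mu_3)$: $[e_1,x]=e_1$, $[e_2,x]=\mu_2e_2$, $[e_3,x]=\mu_3e_3$, $[x,e_1]=-e_1$, $[x,e_2]=-\mu_2e_2$, $[x,e_3]=-\mu_3e_3$; - $L_{21}(\mu_2,\mu_3)$, $\mu_3\ne0$: $[e_1,x]=e_1$, $[e_2,x]=\mu_2e_2$, $[e_3,x]=\mu_3e_3$, $[x,e_1]=-e_1$, $[x,e_2]=-\mu_2e_2$; - $L_{22}(\mu_2,\mu_3)$, $\mu_2,\mu_3\ne0$: $[e_1,x]=e_1$, $[e_2,x]=\mu_2e_2$, $[e_3,x]=\mu_3e_3$,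 $[x,e_1]=-e_1$; - $L_{23}(\mu_2,\mu_3)$: $[e_1,x]=e_1$, $[e_2,x]=\mu_2e_2$, $[e_3,x]=\mu_3e_3$; - $L_{24}(\mu_2)$: $[e_1,x]=e_1$, $[e_2,x]=\mu_2e_2$, $[x,e_1]=-e_1$, $[x,e_2]=-\mu_2e_2$, $[x,x]=e_3$; - $L_{25}(\mu_2)$, $\mu_2\ne0$: $[e_1,x]=e_1$, $[e_2,x]=\mu_2e_2$, $[x,e_1]=-e_1$, $[x,x]=e_3$; - $L_{26}(\mu_2)$: $[e_1,x]=e_1$, $[e_2,x]=\mu_2e_2$, $[x,x]=e_3$; - $L_{27}$: $[e_1,x]=e_1$, $[x,e_1]=-e_1$, $[x,e_2]=e_3$; - $L_{28}$: $[e_1,x]=e_1$, $[x,e_2]=e_3$; - $L_{29}(\mu_3)$: $[e_1,x]=e_1+e_2$, $[e_2,x]=e_2$, $[e_3,x]=\mu_3e_3$, $[x,e_1]=-e_1-e_2$, $[x,e_2]=-e_2$; - $L_{30}$: $[e_1,x]=e_1+e_2$, $[e_2,x]=e_2$, $[x,e_1]=-e_1-e_2$, $[x,e_2]=-e_2$,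 $[x,x]=e_3$; - $L_{31}(\mu_3)$, $\mu_3\ne0$: $[e_1,x]=e_1+e_2$, $[e_2,x]=e_2$, $[e_3,x]=\mu_3e_3$, $[x,e_1]=-e_1-e_2$, $[x,e_2]=-e_2$, $[x,e_3]=-\mu_3e_3$; - $L_{32}(\mu_3)$: $[e_1,x]=e_1+e_2$, $[e_2,x]=e_2$, $[e_3,x]=\mu_3e_3$; - $L_{33}$: $[e_1,x]=e_1+e_2$, $[e_2,x]=e_2$, $[x,x]=e_3$; - $L_{34}(\mu_3)$, $\mu_3\ne0$: $[e_1,x]=e_1+e_2$, $[e_2,x]=e_2$, $[e_3,x]=\mu_3e_3$, $[x,e_3]=-\mu_3e_3$; - $L_{35}(\alpha)$: $[e_1,x]=e_2$, $[e_3,x]=e_3$, $[x,e_1]=\alpha e_2$, $[x,e_3]=-e_3$; - $L_{36}$: $[e_1,x]=e_2$, $[e_3,x]=e_3$, $[x,e_1]=-e_2$, $[x,e_3]=-e_3$, $[x,x]=e_2$; - $L_{37}$: $[e_1,x]=e_2$, $[e_3,x]=e_3$, $[x,e_3]=-e_3$, $[x,x]=e_1$; - $L_{38}(\alpha)$: $[e_1,x]=e_2$,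 $[e_3,x]=e_3$, $[x,e_1]=\alpha e_2$; - $L_{39}$: $[e_1,x]=e_2$, $[e_3,x]=e_3$, $[x,e_1]=-e_2$, $[x,x]=e_2$; - $L_{40}$: $[e_1,x]=e_2$, $[e_3,x]=e_3$, $[x,x]=e_1$; - $L_{41}$: $[e_1,x]=e_1+e_2$, $[e_2,x]=e_2+e_3$, $[e_3,x]=e_3$; - $L_{42}$: $[e_1,x]=e_1+e_2$, $[e_2,x]=e_2+e_3$, $[e_3,x]=e_3$, $[x,e_1]=-e_1-e_2$, $[x,e_2]=-e_2-e_3$, $[x,e_3]=-e_3$. **Proposition.** 1. Every 4-dimensional complex solvable Leibniz algebra whose nilradical is a 3-dimensional abelian algebra is isomorphic to an algebra of exactly one of the families $L_{20},\dots,L_{42}$. 2. Conversely, every algebra of the list is a 4-dimensional solvable Leibniz algebra whose nilradical is 3-dimensional abelian. 3. The algebras of the list are pairwise non-isomorphic, up to the evident reorderings of parameters within a family. That is, algebras of different families are never isomorphic, and two algebras of the same family are isomorphic if and only if their parameters are equal or one of the following applies: - $L_{20}(\mu_2,\mu_3)\cong L_{20}(\nu_2,\nu_3)$ if and only if $\{1,\nu_2,\nu_3\}=\{c,c\mu_2,c\mu_3\}$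 as multisets for some $c\neq0$, and likewise for $L_{23}$; - $L_{21}(\mu_2,\mu_3)\cong L_{21}(\nu_2,\nu_3)$ if and only if $\{1,\nu_2\}=\{c,c\mu_2\}$ as multisets and $\nu_3=c\mu_3$ for some $c\ne0$; - $L_{22}(\mu_2,\mu_3)\cong L_{22}(\nu_2,\nu_3)$ if and only if $\{\nu_2,\nu_3\}=\{\mu_2,\mu_3\}$ as multisets; - $L_{24}(\mu_2)\cong L_{24}(\nu_2)$ if and only if $\nu_2=\mu_2$ or $\mu_2\nu_2=1$, and likewise for $L_{26}$. -/

import Mathlib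

namespace LeibnizClassification

section General

variable {L : Type*} [AddCommGroup L] [Module ℂ L]
variable {L' : Type*} [AddCommGroup L'] [Module ℂ L']

/-- A bilinear bracket `[a, c] = b a c` satisfying the (right) Leibniz identity
`[x,[y,z]] = [[x,y],z] - [[x,z],y]`, i.e. the structure of a Leibniz algebra on `L`. -/
def IsLeibniz (b : L →ₗ[ℂ] L →ₗ[ℂ] L) : Prop :=
  ∀ x y z : L, b x (b y z) = b (b x y) z - b (b x z) y

/-- The series `I, [I, I], [[I, I], I], …`: the lower central series of the algebra `I`. -/
def lowerCentral (b : L →ₗ[ℂ] L →ₗ[ℂ] L) (I : Submodule ℂ L) : ℕ → Submodule ℂ L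
  | 0 => I
  | k + 1 => Submodule.map₂ b (lowerCentral b I k) I

/-- The derived series `L, [L, L], [[L, L], [L, L]], …`. -/
def derived (b : L →ₗ[ℂ] L →ₗ[ℂ] L) : ℕ → Submodule ℂ L
  | 0 => ⊤
  | k + 1 => Submodule.map₂ b (derived b k) (derived b k)

/-- The algebra `(L, b)` is solvable. -/
def IsSolvableAlg (b : L →ₗ[ℂ] L →ₗ[ℂ] L) : Prop :=
  ∃ m : ℕ, derived b m = ⊥

/-- `I` is a two-sided ideal. -/
def IsIdeal (b : L →ₗ[ℂ] L →ₗ[ℂ] L) (I : Submodule ℂ L) : Prop :=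
  ∀ a ∈ I, ∀ y : L, b a y ∈ I ∧ b y a ∈ I

/-- `I` is a two-sided ideal that is nilpotent as an algebra. -/
def IsNilpotentIdeal (b : L →ₗ[ℂ] L →ₗ[ℂ] L) (I : Submodule ℂ L) : Prop :=
  IsIdeal b I ∧ ∃ n : ℕ, lowerCentral b I n = ⊥

/-- `N` is the nilradical: the largest nilpotent ideal. -/
def IsNilradical (b : L →ₗ[ℂ] L →ₗ[ℂ] L) (N : Submodule ℂ L) : Prop :=
  IsGreatest {I : Submodule ℂ L | IsNilpotentIdeal b I} N

/-- `(L, b)` is a 4-dimensional solvable Leibniz algebra whose nilradical is a 3-dimensional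
abelian algebra. -/
structure IsSolvableWithAbelianNilradical (b : L →ₗ[ℂ] L →ₗ[ℂ] L) : Prop where
  leibniz : IsLeibniz b
  finrank_eq : Module.finrank ℂ L = 4
  solvable : IsSolvableAlg b
  nilradical : ∃ N : Submodule ℂ L, IsNilradical b N ∧ Module.finrank ℂ N = 3 ∧
    ∀ a ∈ N, ∀ c ∈ N, b a c = 0

/-- Isomorphism of algebras. -/
def Isomorphic (b : L →ₗ[ℂ] L →ₗ[ℂ] L) (b' : L' →ₗ[ℂ] L' →ₗ[ℂ] L') : Prop :=
  ∃ f : L ≃ₗ[ℂ] L', ∀ a c : L, f (b a c) = b' (f a) (f c)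

end General

/-- The labels of the four basis vectors. -/
inductive Gen : Type
  | e₁ | e₂ | e₃ | x
  deriving DecidableEq

instance : Fintype Gen :=
  ⟨{.e₁, .e₂, .e₃, .x}, fun g => by cases g <;> decide⟩

/-- The 4-dimensional space with basis `e₁, e₂, e₃, x`. -/
abbrev V : Type := Gen → ℂ

/-- The basis vector with a given label. -/
def v (g : Gen) : V := Pi.single g 1

/-- The list of algebras: the labels, with their parameters and the restrictions on these. -/
inductive Label : Type
  | L20 (μ₂ μ₃ : ℂ)
  | L21 (μ₂ μ₃ : ℂ) (h₃ : μ₃ ≠ 0)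
  | L22 (μ₂ μ₃ : ℂ) (h₂ : μ₂ ≠ 0) (h₃ : μ₃ ≠ 0)
  | L23 (μ₂ μ₃ : ℂ)
  | L24 (μ₂ : ℂ)
  | L25 (μ₂ : ℂ) (h₂ : μ₂ ≠ 0)
  | L26 (μ₂ : ℂ)
  | L27
  | L28
  | L29 (μ₃ : ℂ)
  | L30
  | L31 (μ₃ : ℂ) (h₃ : μ₃ ≠ 0)
  | L32 (μ₃ : ℂ)
  | L33
  | L34 (μ₃ : ℂ) (h₃ : μ₃ ≠ 0)
  | L35 (α : ℂ)
  | L36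
  | L37
  | L38 (α : ℂ)
  | L39
  | L40
  | L41
  | L42

/-- The multiplication tables: `table p a c` is the product `[a, c]` in the algebra `p`. -/
noncomputable def table : Label → Gen → Gen → V
  | .L20 μ₂ μ₃ => fun
    | .e₁, .x => v .e₁
    | .e₂, .x => μ₂ • v .e₂
    | .e₃, .x => μ₃ • v .e₃
    | .x, .e₁ => -v .e₁
    | .x, .e₂ => -μ₂ • v .e₂
    | .x, .e₃ => -μ₃ • v .e₃
    | _, _ => 0
  | .L21 μ₂ μ₃ _ => fun
    | .e₁, .x => v .e₁
    | .e₂, .x => μ₂ • v .e₂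
    | .e₃, .x => μ₃ • v .e₃
    | .x, .e₁ => -v .e₁
    | .x, .e₂ => -μ₂ • v .e₂
    | _, _ => 0
  | .L22 μ₂ μ₃ _ _ => fun
    | .e₁, .x => v .e₁
    | .e₂, .x => μ₂ • v .e₂
    | .e₃, .x => μ₃ • v .e₃
    | .x, .e₁ => -v .e₁
    | _, _ => 0
  | .L23 μ₂ μ₃ => fun
    | .e₁, .x => v .e₁
    | .e₂, .x => μ₂ • v .e₂
    | .e₃, .x => μ₃ • v .e₃
    | _, _ => 0
  | .L24 μ₂ => fun
    | .e₁, .x => v .e₁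
    | .e₂, .x => μ₂ • v .e₂
    | .x, .e₁ => -v .e₁
    | .x, .e₂ => -μ₂ • v .e₂
    | .x, .x => v .e₃
    | _, _ => 0
  | .L25 μ₂ _ => fun
    | .e₁, .x => v .e₁
    | .e₂, .x => μ₂ • v .e₂
    | .x, .e₁ => -v .e₁
    | .x, .x => v .e₃
    | _, _ => 0
  | .L26 μ₂ => fun
    | .e₁, .x => v .e₁
    | .e₂, .x => μ₂ • v .e₂
    | .x, .x => v .e₃
    | _, _ => 0
  | .L27 => fun
    | .e₁, .x => v .e₁
    | .x, .e₁ => -v .e₁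
    | .x, .e₂ => v .e₃
    | _, _ => 0
  | .L28 => fun
    | .e₁, .x => v .e₁
    | .x, .e₂ => v .e₃
    | _, _ => 0
  | .L29 μ₃ => fun
    | .e₁, .x => v .e₁ + v .e₂
    | .e₂, .x => v .e₂
    | .e₃, .x => μ₃ • v .e₃
    | .x, .e₁ => -v .e₁ - v .e₂
    | .x, .e₂ => -v .e₂
    | _, _ => 0
  | .L30 => fun
    | .e₁, .x => v .e₁ + v .e₂
    | .e₂, .x => v .e₂
    | .x, .e₁ => -v .e₁ - v .e₂
    | .x, .e₂ => -v .e₂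
    | .x, .x => v .e₃
    | _, _ => 0
  | .L31 μ₃ _ => fun
    | .e₁, .x => v .e₁ + v .e₂
    | .e₂, .x => v .e₂
    | .e₃, .x => μ₃ • v .e₃
    | .x, .e₁ => -v .e₁ - v .e₂
    | .x, .e₂ => -v .e₂
    | .x, .e₃ => -μ₃ • v .e₃
    | _, _ => 0
  | .L32 μ₃ => fun
    | .e₁, .x => v .e₁ + v .e₂
    | .e₂, .x => v .e₂
    | .e₃, .x => μ₃ • v .e₃
    | _, _ => 0
  | .L33 => fun
    | .e₁, .x => v .e₁ + v .e₂
    | .e₂, .x => v .e₂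
    | .x, .x => v .e₃
    | _, _ => 0
  | .L34 μ₃ _ => fun
    | .e₁, .x => v .e₁ + v .e₂
    | .e₂, .x => v .e₂
    | .e₃, .x => μ₃ • v .e₃
    | .x, .e₃ => -μ₃ • v .e₃
    | _, _ => 0
  | .L35 α => fun
    | .e₁, .x => v .e₂
    | .e₃, .x => v .e₃
    | .x, .e₁ => α • v .e₂
    | .x, .e₃ => -v .e₃
    | _, _ => 0
  | .L36 => fun
    | .e₁, .x => v .e₂
    | .e₃, .x => v .e₃
    | .x, .e₁ => -v .e₂
    | .x, .e₃ => -v .e₃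
    | .x, .x => v .e₂
    | _, _ => 0
  | .L37 => fun
    | .e₁, .x => v .e₂
    | .e₃, .x => v .e₃
    | .x, .e₃ => -v .e₃
    | .x, .x => v .e₁
    | _, _ => 0
  | .L38 α => fun
    | .e₁, .x => v .e₂
    | .e₃, .x => v .e₃
    | .x, .e₁ => α • v .e₂
    | _, _ => 0
  | .L39 => fun
    | .e₁, .x => v .e₂
    | .e₃, .x => v .e₃
    | .x, .e₁ => -v .e₂
    | .x, .x => v .e₂
    | _, _ => 0
  | .L40 => fun
    | .e₁, .x => v .e₂
    | .e₃, .x => v .e₃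
    | .x, .x => v .e₁
    | _, _ => 0
  | .L41 => fun
    | .e₁, .x => v .e₁ + v .e₂
    | .e₂, .x => v .e₂ + v .e₃
    | .e₃, .x => v .e₃
    | _, _ => 0
  | .L42 => fun
    | .e₁, .x => v .e₁ + v .e₂
    | .e₂, .x => v .e₂ + v .e₃
    | .e₃, .x => v .e₃
    | .x, .e₁ => -v .e₁ - v .e₂
    | .x, .e₂ => -v .e₂ - v .e₃
    | .x, .e₃ => -v .e₃
    | _, _ => 0

/-- The algebra with label `p`: the bilinear bracket on `V` with the given products of basis
vectors. -/
noncomputable def algebra (p : Label) : V →ₗ[ℂ] V →ₗ[ℂ] V :=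
  (Pi.basisFun ℂ Gen).constr ℂ fun a => (Pi.basisFun ℂ Gen).constr ℂ fun c => table p a c

/-- The number of the family to which an algebra of the list belongs. -/
def Label.family : Label → ℕ
  | .L20 _ _ => 20
  | .L21 _ _ _ => 21
  | .L22 _ _ _ _ => 22
  | .L23 _ _ => 23
  | .L24 _ => 24
  | .L25 _ _ => 25
  | .L26 _ => 26
  | .L27 => 27
  | .L28 => 28
  | .L29 _ => 29
  | .L30 => 30
  | .L31 _ _ => 31
  | .L32 _ => 32
  | .L33 => 33
  | .L34 _ _ => 34
  | .L35 _ => 35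
  | .L36 => 36
  | .L37 => 37
  | .L38 _ => 38
  | .L39 => 39
  | .L40 => 40
  | .L41 => 41
  | .L42 => 42

/-- The coincidences inside a family: the evident changes of parameters coming from a
permutation of `e₁, e₂, e₃` together with a rescaling of `x`. In the six families named here the
normalisation `[e₁, x] = e₁` leaves this freedom; otherwise the two labels have to be equal. -/
def Label.SameUpToReordering : Label → Label → Prop
  | .L20 μ₂ μ₃, .L20 ν₂ ν₃ =>
      ∃ c : ℂ, c ≠ 0 ∧ ({1, ν₂, ν₃} : Multiset ℂ) = {c, c * μ₂, c * μ₃}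
  | .L21 μ₂ μ₃ _, .L21 ν₂ ν₃ _ =>
      ∃ c : ℂ, c ≠ 0 ∧ ({1, ν₂} : Multiset ℂ) = {c, c * μ₂} ∧ ν₃ = c * μ₃
  | .L22 μ₂ μ₃ _ _, .L22 ν₂ ν₃ _ _ => ({ν₂, ν₃} : Multiset ℂ) = {μ₂, μ₃}
  | .L23 μ₂ μ₃, .L23 ν₂ ν₃ =>
      ∃ c : ℂ, c ≠ 0 ∧ ({1, ν₂, ν₃} : Multiset ℂ) = {c, c * μ₂, c * μ₃}
  | .L24 μ₂, .L24 ν₂ => ν₂ = μ₂ ∨ μ₂ * ν₂ = 1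
  | .L26 μ₂, .L26 ν₂ => ν₂ = μ₂ ∨ μ₂ * ν₂ = 1
  | p, q => p = q

end LeibnizClassification

open LeibnizClassification

/-!
An algebra in question is determined by its nilradical `N`, an abelian ideal of codimension one, and
by the action of an element `x ∉ N`: the operators `R n = [n, x]` and `S n = [x, n]` on `N`, and the
vector `w = [x, x]`, which lies in `N`. The Leibniz identity amounts to `R S = S R`, `S² = -S R` and
`S w = 0`, and the condition on the nilradical to `R` not being nilpotent
(`IsSolvableWithAbelianNilradical.exists_extBracket`). Since `N` can be recovered from the bracket,
isomorphisms of algebras correspond to conjugations of `(R, S)`, combined with the changes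
`x ↦ c x + n₀`, which multiply `(R, S)` by `c` and replace `w` by `c² w + c (R + S) n₀`
(`DataEquiv.isomorphic`, `dataEquiv_of_isomorphic`). The classification is thus one of triples
`(R, S, w)` in dimension three.

Existence. Where `R` is invertible, `S (S + R) = 0` splits `N` into a part with `S = -R` and a part
with `S = 0`, and there `w` can be removed; where `R` is nilpotent, the dimension is at most two and
the pair `(R, S)` is `(0, 0)`, `(0, E)` or `(E, α E)` with `E² = 0`
(`exists_decomposition`, `Decomposition.exists_basis_pair`). Jordan bases of `R` on the invertible
parts then give a case distinction on the dimensions of the three parts, each case of which consists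
of algebras of the list (`exists_label_dataEquiv`).

Separation. The lengths of the Jordan chains of `R`, the action of `S` on the kernel of `R` and on
the nilpotent Jordan chains of `R`, and the solvability of `w = R n + S n` are invariants
(`DataEquiv.jordanType_eq`). So are, up to a common factor, the eigenvalues of `R`, `S` and `R + S`,
which are the diagonal entries of triangular matrices (`DataEquiv.diagonal_eq`). Together they
determine the family and the parameters up to the stated coincidences
(`DataEquiv.sameUpToReordering`), all of which come from permutations and rescalings of the basis
(`Label.SameUpToReordering.isomorphic`).
-/

open LeibnizClassification

namespace LeibnizClassification

/-! ### Abelian extensions by one element -/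

section General

variable {L : Type*} [AddCommGroup L] [Module ℂ L]
variable {L' : Type*} [AddCommGroup L'] [Module ℂ L']
variable {L'' : Type*} [AddCommGroup L''] [Module ℂ L'']
variable {N : Type*} [AddCommGroup N] [Module ℂ N]
variable {N' : Type*} [AddCommGroup N'] [Module ℂ N']
variable {N'' : Type*} [AddCommGroup N''] [Module ℂ N'']

theorem Isomorphic.symm {b : L →ₗ[ℂ] L →ₗ[ℂ] L} {b' : L' →ₗ[ℂ] L' →ₗ[ℂ] L'}
    (h : Isomorphic b b') : Isomorphic b' b := by
  obtain ⟨f, hf⟩ := h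
  refine ⟨f.symm, fun a c => ?_⟩
  rw [LinearEquiv.symm_apply_eq, hf, f.apply_symm_apply, f.apply_symm_apply]

theorem Isomorphic.trans {b : L →ₗ[ℂ] L →ₗ[ℂ] L} {b' : L' →ₗ[ℂ] L' →ₗ[ℂ] L'}
    {b'' : L'' →ₗ[ℂ] L'' →ₗ[ℂ] L''} (h : Isomorphic b b') (h' : Isomorphic b' b'') :
    Isomorphic b b'' := by
  obtain ⟨f, hf⟩ := h
  obtain ⟨g, hg⟩ := h'
  exact ⟨f.trans g, fun a c => by simp [hf, hg]⟩

/-- The bracket on `N × ℂ` for which `N` is an abelian ideal and the element `x = (0, 1)` satisfies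
`[n, x] = R n`, `[x, n] = S n` and `[x, x] = w`. -/
noncomputable def extBracket (R S : Module.End ℂ N) (w : N) :
    N × ℂ →ₗ[ℂ] N × ℂ →ₗ[ℂ] N × ℂ :=
  LinearMap.mk₂ ℂ (fun u u' => (u'.2 • R u.1 + u.2 • S u'.1 + (u.2 * u'.2) • w, 0))
    (fun a b c => by ext <;> simp; module)
    (fun a b c => by ext <;> simp; module)
    (fun a b c => by ext <;> simp; module)
    (fun a b c => by ext <;> simp; module)

theorem extBracket_apply (R S : Module.End ℂ N) (w : N) (u u' : N × ℂ) :
    extBracket R S w u u' = (u'.2 • R u.1 + u.2 • S u'.1 + (u.2 * u'.2) • w, 0) := rfl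

/-- The data `(R, S, w)` and `(R', S', w')` agree up to a linear isomorphism `φ` of the ideals and
a change `x ↦ c x' + n₀` of the complementary element. -/
def DataEquiv (R S : Module.End ℂ N) (w : N) (R' S' : Module.End ℂ N') (w' : N') : Prop :=
  ∃ (φ : N ≃ₗ[ℂ] N') (c : ℂ) (n₀ : N'), c ≠ 0 ∧ (∀ n, φ (R n) = c • R' (φ n)) ∧
    (∀ n, φ (S n) = c • S' (φ n)) ∧ φ w = c ^ 2 • w' + c • (R' n₀ + S' n₀)

theorem DataEquiv.isomorphic {R S : Module.End ℂ N} {w : N} {R' S' : Module.End ℂ N'} {w' : N'}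
    (h : DataEquiv R S w R' S' w') : Isomorphic (extBracket R S w) (extBracket R' S' w') := by
  obtain ⟨φ, c, n₀, hc, hR, hS, hw⟩ := h
  let f : (N × ℂ) →ₗ[ℂ] N' × ℂ :=
    { toFun := fun u => (φ u.1 + u.2 • n₀, c * u.2)
      map_add' := fun u v => by ext <;> simp <;> first | module | ring
      map_smul' := fun t u => by ext <;> simp <;> first | module | ring }
  let g : (N' × ℂ) →ₗ[ℂ] N × ℂ :=
    { toFun := fun u => (φ.symm (u.1 - (c⁻¹ * u.2) • n₀), c⁻¹ * u.2)
      map_add' := fun u v => by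
        ext
        · simp; module
        · simp; ring
      map_smul' := fun t u => by
        ext
        · simp; module
        · simp; ring }
  refine ⟨LinearEquiv.ofLinearMap f g ?_ ?_, ?_⟩
  · ext u <;> simp [f, g, hc]
  · ext u <;> simp [f, g, hc]
  · rintro ⟨n, t⟩ ⟨m, s⟩
    ext
    · simp only [LinearEquiv.coe_ofLinearMap, extBracket_apply, f, LinearMap.coe_mk,
        AddHom.coe_mk, map_add, map_smul, hR, hS, hw]
      module
    · simp [extBracket_apply, f]

/-- When `R² ≠ 0`, the ideal `N` is recovered from the bracket as the set of the elements `y` for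
which `[·, y]` squares to zero; so every isomorphism maps ideal to ideal. -/
theorem snd_eq_zero_of_extBracket_equiv {R S : Module.End ℂ N} {w : N} {R' S' : Module.End ℂ N'}
    {w' : N'} (hR2' : ∃ n, R' (R' n) ≠ 0) (f : (N × ℂ) ≃ₗ[ℂ] N' × ℂ)
    (hf : ∀ a c, f (extBracket R S w a c) = extBracket R' S' w' (f a) (f c)) (n : N) :
    (f (n, 0)).2 = 0 := by
  obtain ⟨m, hm⟩ := hR2'
  have h0 : extBracket R S w (extBracket R S w (f.symm (m, 0)) (n, 0)) (n, 0) = 0 := by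
    ext <;> simp [extBracket_apply]
  have h1 := congrArg f h0
  rw [hf, hf, f.apply_symm_apply, map_zero] at h1
  simpa [extBracket_apply, hm] using congrArg Prod.fst h1

theorem dataEquiv_of_isomorphic {R S : Module.End ℂ N} {w : N} {R' S' : Module.End ℂ N'} {w' : N'}
    (hR2 : ∃ n, R (R n) ≠ 0) (hR2' : ∃ n, R' (R' n) ≠ 0)
    (h : Isomorphic (extBracket R S w) (extBracket R' S' w')) : DataEquiv R S w R' S' w' := by
  obtain ⟨f, hf⟩ := h
  have hf' : ∀ a c, f.symm (extBracket R' S' w' a c) = extBracket R S w (f.symm a) (f.symm c) := by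
    intro a c
    rw [LinearEquiv.symm_apply_eq, hf, f.apply_symm_apply, f.apply_symm_apply]
  have k1 : ∀ n, f (n, 0) = ((f (n, 0)).1, 0) :=
    fun n => Prod.ext rfl (snd_eq_zero_of_extBracket_equiv hR2' f hf n)
  have k2 : ∀ n, f.symm (n, 0) = ((f.symm (n, 0)).1, 0) :=
    fun n => Prod.ext rfl (snd_eq_zero_of_extBracket_equiv hR2 f.symm hf' n)
  let φ : N ≃ₗ[ℂ] N' := LinearEquiv.ofLinearMap
    ((LinearMap.fst ℂ N' ℂ) ∘ₗ f.toLinearMap ∘ₗ (LinearMap.inl ℂ N ℂ))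
    ((LinearMap.fst ℂ N ℂ) ∘ₗ f.symm.toLinearMap ∘ₗ (LinearMap.inl ℂ N' ℂ))
    (by ext n; simp [← k2]) (by ext n; simp [← k1])
  have hφ : ∀ n, f (n, 0) = (φ n, 0) := fun n => k1 n
  obtain ⟨n₀, c, hx⟩ : ∃ n₀ c, f (0, 1) = (n₀, c) := ⟨_, _, rfl⟩
  have hc : c ≠ 0 := by
    rintro rfl
    have : f (0, 1) = f (φ.symm n₀, 0) := by rw [hx, hφ, φ.apply_symm_apply]
    simpa using f.injective this
  refine ⟨φ, c, n₀, hc, fun n => ?_, fun n => ?_, ?_⟩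
  · have := hf (n, 0) (0, 1)
    rw [hφ, hx] at this
    simpa [extBracket_apply, hφ] using this
  · have := hf (0, 1) (n, 0)
    rw [hφ, hx] at this
    simpa [extBracket_apply, hφ] using this
  · have := hf (0, 1) (0, 1)
    rw [hx] at this
    simp only [extBracket_apply, map_zero, smul_zero, zero_add, one_smul, mul_one, hφ,
      Prod.mk.injEq, and_true] at this
    rw [this]
    module

theorem isLeibniz_extBracket {R S : Module.End ℂ N} {w : N} (hRS : ∀ n, R (S n) = S (R n))
    (hSS : ∀ n, S (S n) = -S (R n)) (hw : S w = 0) : IsLeibniz (extBracket R S w) := by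
  rintro ⟨n, t⟩ ⟨m, s⟩ ⟨k, r⟩
  ext
  · simp only [extBracket_apply, map_add, map_smul, hRS, hSS, hw, Prod.fst_sub]
    module
  · simp [extBracket_apply]

theorem IsLeibniz.of_isomorphic {b : L →ₗ[ℂ] L →ₗ[ℂ] L} {b' : L' →ₗ[ℂ] L' →ₗ[ℂ] L'}
    (h : Isomorphic b b') (hb : IsLeibniz b') : IsLeibniz b := by
  obtain ⟨f, hf⟩ := h
  intro x y z
  apply f.injective
  rw [map_sub]
  simp only [hf]
  exact hb _ _ _

/-- A criterion for an abelian ideal `N` containing `[L, L]` to be the nilradical: each `y ∉ N`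
acts from the right on `N` with a nonzero eigenvalue. -/
theorem isSolvableWithAbelianNilradical_of_eigenvector {b : L →ₗ[ℂ] L →ₗ[ℂ] L} (hb : IsLeibniz b)
    (hL : Module.finrank ℂ L = 4) (N : Submodule ℂ L) (hN : Module.finrank ℂ N = 3)
    (hab : ∀ a ∈ N, ∀ c ∈ N, b a c = 0) (hder : ∀ a c, b a c ∈ N)
    (heig : ∀ y ∉ N, ∃ m ∈ N, m ≠ 0 ∧ ∃ t : ℂ, t ≠ 0 ∧ b m y = t • m) :
    IsSolvableWithAbelianNilradical b := by
  refine ⟨hb, hL, ⟨2, ?_⟩, N, ⟨⟨fun a ha y => ⟨hder _ _, hder _ _⟩, 1, ?_⟩, ?_⟩, hN, hab⟩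
  · have h1 : derived b 1 ≤ N := Submodule.map₂_le.2 fun a _ c _ => hder a c
    exact le_bot_iff.1 (Submodule.map₂_le.2 fun a ha c hc => by
      simpa using hab a (h1 ha) c (h1 hc))
  · exact le_bot_iff.1 (Submodule.map₂_le.2 fun a ha c hc => by simpa using hab a ha c hc)
  · rintro I ⟨hI, n, hn⟩ y hy
    by_contra hyN
    obtain ⟨m, -, hm0, t, ht, hmt⟩ := heig y hyN
    have hmem : ∀ J : Submodule ℂ L, b m y ∈ J → m ∈ J := fun J h => by
      rw [hmt] at h
      exact (J.smul_mem_iff ht).1 h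
    have hmI : ∀ k, m ∈ lowerCentral b I k := by
      intro k
      induction k with
      | zero => exact hmem _ (hI y hy m).2
      | succ k ih => exact hmem _ (Submodule.apply_mem_map₂ b ih hy)
    have := hmI n
    rw [hn] at this
    exact hm0 (by simpa using this)

/-- Every algebra in question is an extension of its nilradical by one element. -/
theorem IsSolvableWithAbelianNilradical.exists_extBracket {b : L →ₗ[ℂ] L →ₗ[ℂ] L}
    (h : IsSolvableWithAbelianNilradical b) :
    ∃ (N : Submodule ℂ L) (R S : Module.End ℂ N) (w : N), Module.finrank ℂ N = 3 ∧
      (∀ n, R (S n) = S (R n)) ∧ (∀ n, S (S n) = -S (R n)) ∧ S w = 0 ∧ ¬ IsNilpotent R ∧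
      Isomorphic b (extBracket R S w) := by
  obtain ⟨hb, hL, -, N, ⟨⟨hI, -⟩, hmax⟩, hN, hab⟩ := h
  have : FiniteDimensional ℂ L := Module.finite_of_finrank_pos (by omega)
  have hNtop : N ≠ ⊤ := by
    rintro rfl
    rw [finrank_top] at hN
    omega
  obtain ⟨x, hx⟩ : ∃ x, x ∉ N := by
    by_contra! hcon
    exact hNtop (Submodule.eq_top_iff'.2 hcon)
  let F : N × ℂ →ₗ[ℂ] L := N.subtype.coprod (LinearMap.toSpanSingleton ℂ L x)
  have hF : ∀ n t, F (n, t) = n + t • x := fun n t => by simp [F]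
  have hFinj : Function.Injective F := by
    rw [← LinearMap.ker_eq_bot, LinearMap.ker_eq_bot']
    rintro ⟨n, t⟩ hnt
    rw [hF] at hnt
    have ht : t = 0 := by
      by_contra ht
      apply hx
      rw [← N.smul_mem_iff ht, eq_neg_of_add_eq_zero_right hnt]
      exact N.neg_mem n.2
    subst ht
    simpa using hnt
  let f : (N × ℂ) ≃ₗ[ℂ] L := LinearEquiv.ofInjectiveOfFinrankEq F hFinj (by
    rw [Module.finrank_prod, hN, hL, Module.finrank_self])
  have hf : ∀ n t, f (n, t) = n + t • x := fun n t => hF n t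
  have hdec : ∀ y, ∃ (n : N) (t : ℂ), y = n + t • x := fun y =>
    ⟨(f.symm y).1, (f.symm y).2, by rw [← hf]; simp⟩
  -- The quotient by `N` is one-dimensional, and `[x, [x, x]] = 0` forces its bracket to vanish.
  have hxx : b x x ∈ N := by
    obtain ⟨n, t, hnt⟩ := hdec (b x x)
    have h0 : b x (b x x) = 0 := by rw [hb x x x, sub_self]
    rw [hnt, map_add, map_smul, hnt] at h0
    have h1 : t • t • x ∈ N := by
      have : t • t • x = -(b x n + t • (n : L)) := by
        rw [smul_add, ← add_assoc] at h0
        exact eq_neg_of_add_eq_zero_right h0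
      rw [this]
      exact N.neg_mem (N.add_mem (hI n n.2 x).2 (N.smul_mem _ n.2))
    have ht : t = 0 := by
      by_contra ht
      exact hx ((N.smul_mem_iff ht).1 ((N.smul_mem_iff ht).1 h1))
    rw [hnt, ht, zero_smul, add_zero]
    exact n.2
  let R : Module.End ℂ N := (b.flip x).restrict fun n hn => (hI n hn x).1
  let S : Module.End ℂ N := (b x).restrict fun n hn => (hI n hn x).2
  have hR : ∀ n, (R n : L) = b n x := fun n => rfl
  have hS : ∀ n, (S n : L) = b x n := fun n => rfl
  have hiso : Isomorphic b (extBracket R S ⟨b x x, hxx⟩) := by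
    apply Isomorphic.symm
    refine ⟨f, ?_⟩
    rintro ⟨n, t⟩ ⟨m, s⟩
    rw [hf, hf, extBracket_apply, hf]
    simp only [Submodule.coe_add, Submodule.coe_smul, hR, hS, map_add, map_smul,
      LinearMap.add_apply, LinearMap.smul_apply, hab n n.2 m m.2]
    module
  have hRS : ∀ n, R (S n) = S (R n) := by
    intro n
    ext
    rw [hR, hS, hS, hR, hb, hab _ hxx n n.2, sub_zero]
  refine ⟨N, R, S, ⟨b x x, hxx⟩, hN, hRS, fun n => ?_, ?_, ?_, hiso⟩
  · rw [← hRS]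
    ext
    rw [Submodule.coe_neg, hS, hR, hS, hb, hab _ hxx n n.2, zero_sub]
  · ext
    rw [hS]
    change b x (b x x) = _
    rw [hb x x x, sub_self]
    rfl
  · -- If `R` were nilpotent, so would be the whole algebra.
    rintro ⟨k, hk⟩
    have hlc : ∀ j, ∀ y ∈ lowerCentral b ⊤ (j + 1), ∃ n, y = (R ^ j) n := by
      intro j
      suffices lowerCentral b ⊤ (j + 1) ≤ ((R ^ j).range).map N.subtype by
        intro y hy
        obtain ⟨-, ⟨n, rfl⟩, rfl⟩ := this hy
        exact ⟨n, rfl⟩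
      induction j with
      | zero =>
        refine Submodule.map₂_le.2 fun a _ c _ => ?_
        refine ⟨⟨b a c, ?_⟩, by simp, rfl⟩
        obtain ⟨n, t, rfl⟩ := hdec a
        obtain ⟨m, s, rfl⟩ := hdec c
        simp only [map_add, map_smul, LinearMap.add_apply, LinearMap.smul_apply]
        exact N.add_mem (N.add_mem (hI m m.2 _).2 (N.smul_mem _ (hI m m.2 _).2))
          (N.smul_mem _ (N.add_mem (hI n n.2 _).1 (N.smul_mem _ hxx)))
      | succ j ih =>
        refine Submodule.map₂_le.2 fun a ha c _ => ?_
        obtain ⟨-, ⟨n, rfl⟩, rfl⟩ := ih ha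
        obtain ⟨m, s, rfl⟩ := hdec c
        refine ⟨(R ^ (j + 1)) (s • n), ⟨_, rfl⟩, ?_⟩
        rw [pow_succ', Module.End.mul_apply]
        simp only [map_add, map_smul, Submodule.subtype_apply, hR,
          hab _ ((R ^ j) n).2 m m.2, zero_add]
    have htop : IsNilpotentIdeal b (⊤ : Submodule ℂ L) := by
      refine ⟨fun _ _ _ => ⟨trivial, trivial⟩, k + 1, (Submodule.eq_bot_iff _).2 fun y hy => ?_⟩
      obtain ⟨n, rfl⟩ := hlc k y hy
      simp [hk]
    exact hNtop (top_le_iff.1 (hmax htop))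

end General

/-! ### The data of the algebras of the list -/

/-- The labels of the basis of the nilradical. -/
def idx : Fin 3 → Gen := ![.e₁, .e₂, .e₃]

/-- The matrix of `n ↦ [n, x]` in the basis `e₁, e₂, e₃`. -/
noncomputable def Label.rightMat (p : Label) : Matrix (Fin 3) (Fin 3) ℂ :=
  .of fun i j => table p (idx j) .x (idx i)

/-- The matrix of `n ↦ [x, n]` in the basis `e₁, e₂, e₃`. -/
noncomputable def Label.leftMat (p : Label) : Matrix (Fin 3) (Fin 3) ℂ :=
  .of fun i j => table p .x (idx j) (idx i)

/-- The operator `n ↦ [n, x]`. -/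
noncomputable def Label.R (p : Label) : Module.End ℂ (Fin 3 → ℂ) := p.rightMat.mulVecLin

/-- The operator `n ↦ [x, n]`. -/
noncomputable def Label.S (p : Label) : Module.End ℂ (Fin 3 → ℂ) := p.leftMat.mulVecLin

/-- The coordinates of `[x, x]`. -/
noncomputable def Label.w (p : Label) : Fin 3 → ℂ := fun i => table p .x .x (idx i)

theorem sum_gen {M : Type*} [AddCommMonoid M] (f : Gen → M) :
    ∑ g, f g = f .e₁ + f .e₂ + f .e₃ + f .x := by
  have : (Finset.univ : Finset Gen) = {.e₁, .e₂, .e₃, .x} := by decide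
  rw [this]
  simp [add_assoc]

theorem v_apply (g h : Gen) : v g h = if h = g then 1 else 0 := by
  simp [v, Pi.single_apply]

theorem table_apply_x (p : Label) (a c : Gen) : table p a c .x = 0 := by
  cases p <;> cases a <;> cases c <;> simp [table, v_apply]

theorem table_idx_idx (p : Label) (i j : Fin 3) : table p (idx i) (idx j) = 0 := by
  cases p <;> fin_cases i <;> fin_cases j <;> rfl

theorem algebra_apply (p : Label) (a c : V) :
    algebra p a c = ∑ g, ∑ h, (a g * c h) • table p g h := by
  simp only [algebra, Module.Basis.constr_apply_fintype, LinearMap.sum_apply,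
    LinearMap.smul_apply, Pi.basisFun_equivFun, LinearEquiv.refl_apply, Finset.smul_sum, mul_smul]

theorem algebra_isomorphic (p : Label) : Isomorphic (algebra p) (extBracket p.R p.S p.w) := by
  let f : V →ₗ[ℂ] (Fin 3 → ℂ) × ℂ :=
    { toFun := fun u => (fun i => u (idx i), u .x)
      map_add' := fun u u' => rfl
      map_smul' := fun t u => rfl }
  let g : ((Fin 3 → ℂ) × ℂ) →ₗ[ℂ] V :=
    { toFun := fun u h => match h with
        | .e₁ => u.1 0
        | .e₂ => u.1 1
        | .e₃ => u.1 2
        | .x => u.2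
      map_add' := fun u u' => by ext h; cases h <;> rfl
      map_smul' := fun t u => by ext h; cases h <;> rfl }
  refine ⟨LinearEquiv.ofLinearMap f g ?_ ?_, fun a c => ?_⟩
  · refine LinearMap.ext fun u => Prod.ext (funext fun i => ?_) rfl
    fin_cases i <;> rfl
  · refine LinearMap.ext fun u => funext fun h => ?_
    cases h <;> rfl
  · have t00 := table_idx_idx p 0 0
    have t01 := table_idx_idx p 0 1
    have t02 := table_idx_idx p 0 2
    have t10 := table_idx_idx p 1 0
    have t11 := table_idx_idx p 1 1
    have t12 := table_idx_idx p 1 2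
    have t20 := table_idx_idx p 2 0
    have t21 := table_idx_idx p 2 1
    have t22 := table_idx_idx p 2 2
    refine Prod.ext (funext fun i => ?_) ?_
    · simp only [idx, Matrix.cons_val] at t00 t01 t02 t10 t11 t12 t20 t21 t22
      simp [f, extBracket_apply, algebra_apply, sum_gen, Label.R, Label.S, Label.w,
        Label.rightMat, Label.leftMat, Matrix.mulVec, dotProduct, Fin.sum_univ_three, t00, t01,
        t02, t10, t11, t12, t20, t21, t22, idx]
      ring
    · change algebra p a c .x = 0
      simp [algebra_apply, table_apply_x, Finset.sum_apply]

theorem Label.R_apply (p : Label) (u : Fin 3 → ℂ) (i : Fin 3) :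
    p.R u i = ∑ j, table p (idx j) .x (idx i) * u j := rfl

theorem Label.S_apply (p : Label) (u : Fin 3 → ℂ) (i : Fin 3) :
    p.S u i = ∑ j, table p .x (idx j) (idx i) * u j := rfl

theorem Label.R_S (p : Label) (u : Fin 3 → ℂ) : p.R (p.S u) = p.S (p.R u) := by
  ext i
  cases p <;> fin_cases i <;>
    simp [Label.R_apply, Label.S_apply, Fin.sum_univ_three, idx, table, v_apply] <;> ring

theorem Label.S_S (p : Label) (u : Fin 3 → ℂ) : p.S (p.S u) = -p.S (p.R u) := by
  ext i
  cases p <;> fin_cases i <;>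
    simp [Label.R_apply, Label.S_apply, Fin.sum_univ_three, idx, table, v_apply] <;> ring

theorem Label.S_w (p : Label) : p.S p.w = 0 := by
  ext i
  cases p <;> fin_cases i <;>
    simp [Label.w, Label.S_apply, Fin.sum_univ_three, idx, table, v_apply]

theorem Label.exists_table_eq (p : Label) :
    ∃ i, table p (idx i) .x = v (idx i) := by
  cases p
  case L29 | L30 | L31 | L32 | L33 | L34 => exact ⟨1, rfl⟩
  case L35 | L36 | L37 | L38 | L39 | L40 | L41 | L42 => exact ⟨2, rfl⟩
  all_goals exact ⟨0, rfl⟩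

theorem Label.exists_R_eq (p : Label) : ∃ n ≠ 0, p.R n = n := by
  obtain ⟨i, hi⟩ := p.exists_table_eq
  refine ⟨Pi.single i 1, by simp, funext fun j => ?_⟩
  rw [p.R_apply, Fintype.sum_eq_single i (by simp +contextual), hi]
  fin_cases i <;> fin_cases j <;> simp [idx, v_apply]

theorem Label.isSolvableWithAbelianNilradical (p : Label) :
    IsSolvableWithAbelianNilradical (algebra p) := by
  have hV : Module.finrank ℂ V = 4 := by
    rw [Module.finrank_fintype_fun_eq_card]
    rfl
  have hx : ∀ a c, algebra p a c .x = 0 := fun a c => by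
    simp [algebra_apply, table_apply_x, Finset.sum_apply]
  let ξ : V →ₗ[ℂ] ℂ := LinearMap.proj .x
  have hmem : ∀ a : V, a ∈ LinearMap.ker ξ ↔ a .x = 0 := fun a => Iff.rfl
  have h00 : ∀ g h, g ≠ .x → h ≠ .x → table p g h = 0 := by
    intro g h hg hh
    cases p <;> cases g <;> cases h <;> first | rfl | contradiction
  refine isSolvableWithAbelianNilradical_of_eigenvector
    (IsLeibniz.of_isomorphic (algebra_isomorphic p) (isLeibniz_extBracket p.R_S p.S_S p.S_w))
    hV (LinearMap.ker ξ) ?_ ?_ (fun a c => hx a c) ?_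
  · have h1 := LinearMap.finrank_range_add_finrank_ker ξ
    have h2 : LinearMap.range ξ = ⊤ :=
      LinearMap.range_eq_top.2 fun t => ⟨t • v .x, by simp [ξ, v_apply]⟩
    rw [h2, finrank_top, Module.finrank_self, hV] at h1
    omega
  · intro a ha c hc
    rw [hmem] at ha hc
    rw [algebra_apply]
    refine Finset.sum_eq_zero fun g _ => Finset.sum_eq_zero fun h _ => ?_
    by_cases hg : g = .x
    · simp [hg, ha]
    by_cases hh : h = .x
    · simp [hh, hc]
    rw [h00 g h hg hh, smul_zero]
  · intro y hy
    obtain ⟨i, hi⟩ := p.exists_table_eq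
    have hne : idx i ≠ .x := by fin_cases i <;> simp [idx]
    refine ⟨v (idx i), ?_, ?_, y .x, hy, ?_⟩
    · rw [hmem, v_apply, if_neg hne.symm]
    · simp [v]
    · rw [algebra_apply, Fintype.sum_eq_single (idx i) (by simp +contextual [v_apply]),
        Fintype.sum_eq_single .x fun h hh => by rw [h00 _ _ hne hh, smul_zero], hi]
      simp [v_apply]

theorem isomorphic_algebra_iff (p q : Label) :
    Isomorphic (algebra p) (algebra q) ↔ DataEquiv p.R p.S p.w q.R q.S q.w := by
  have hR2 : ∀ p : Label, ∃ n, p.R (p.R n) ≠ 0 := fun p => by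
    obtain ⟨n, hn, h⟩ := p.exists_R_eq
    exact ⟨n, by rwa [h, h]⟩
  refine ⟨fun h => dataEquiv_of_isomorphic (hR2 p) (hR2 q)
    ((algebra_isomorphic p).symm.trans (h.trans (algebra_isomorphic q))), fun h => ?_⟩
  exact (algebra_isomorphic p).trans (h.isomorphic.trans (algebra_isomorphic q).symm)

/-! ### Jordan bases in dimensions two and three -/

section Jordan

variable {W : Type*} [AddCommGroup W] [Module ℂ W]

theorem exists_basis_of_span_pair (hW : Module.finrank ℂ W = 2) {u v : W}
    (h : ∀ n, ∃ a b : ℂ, n = a • u + b • v) :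
    ∃ B : Module.Basis (Fin 2) ℂ W, B 0 = u ∧ B 1 = v := by
  refine ⟨basisOfTopLeSpanOfCardEqFinrank ![u, v] (fun n _ => ?_) (by simp [hW]), ?_, ?_⟩
  · obtain ⟨a, b, rfl⟩ := h n
    exact add_mem (Submodule.smul_mem _ _ (Submodule.subset_span ⟨0, rfl⟩))
      (Submodule.smul_mem _ _ (Submodule.subset_span ⟨1, rfl⟩))
  · simp
  · simp

theorem exists_basis_of_span_triple (hW : Module.finrank ℂ W = 3) {u v z : W}
    (h : ∀ n, ∃ a b c : ℂ, n = a • u + b • v + c • z) :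
    ∃ B : Module.Basis (Fin 3) ℂ W, B 0 = u ∧ B 1 = v ∧ B 2 = z := by
  refine ⟨basisOfTopLeSpanOfCardEqFinrank ![u, v, z] (fun n _ => ?_) (by simp [hW]), ?_, ?_, ?_⟩
  · obtain ⟨a, b, c, rfl⟩ := h n
    exact add_mem (add_mem (Submodule.smul_mem _ _ (Submodule.subset_span ⟨0, rfl⟩))
      (Submodule.smul_mem _ _ (Submodule.subset_span ⟨1, rfl⟩)))
      (Submodule.smul_mem _ _ (Submodule.subset_span ⟨2, rfl⟩))
  · simp
  · simp
  · simp

theorem exists_span_pair (hW : Module.finrank ℂ W = 2) {v : W} (hv : v ≠ 0) :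
    ∃ u, ∀ n, ∃ a b : ℂ, n = a • u + b • v := by
  obtain ⟨u, hu⟩ := exists_linearIndependent_pair_of_one_lt_finrank (R := ℂ) (by omega) hv
  let B := basisOfLinearIndependentOfCardEqFinrank hu (by simp [hW])
  refine ⟨u, fun n => ⟨B.repr n 1, B.repr n 0, ?_⟩⟩
  have := B.sum_repr n
  simp only [Fin.sum_univ_two, B, coe_basisOfLinearIndependentOfCardEqFinrank,
    Matrix.cons_val_zero, Matrix.cons_val_one] at this
  rw [add_comm]
  exact this.symm

theorem exists_jordan_pair (hW : Module.finrank ℂ W = 2) (T : Module.End ℂ W) :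
    ∃ u v : W, (∀ n, ∃ a b : ℂ, n = a • u + b • v) ∧
      ((∃ a b : ℂ, T u = a • u ∧ T v = b • v) ∨ ∃ a : ℂ, T u = a • u + v ∧ T v = a • v) := by
  have : FiniteDimensional ℂ W := Module.finite_of_finrank_pos (by omega)
  have : Nontrivial W := Module.nontrivial_of_finrank_pos (R := ℂ) (by omega)
  obtain ⟨b, hb⟩ := Module.End.exists_eigenvalue T
  obtain ⟨v, hv⟩ := hb.exists_hasEigenvector
  have hTv : T v = b • v := hv.apply_eq_smul
  obtain ⟨u, hu⟩ := exists_span_pair hW hv.2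
  obtain ⟨a, c, hTu⟩ := hu (T u)
  by_cases hab : a = b
  · subst hab
    by_cases hc : c = 0
    · exact ⟨u, v, hu, .inl ⟨a, a, by simp [hTu, hc], hTv⟩⟩
    · refine ⟨u, c • v, fun n => ?_, .inr ⟨a, hTu, by rw [map_smul, hTv, smul_comm]⟩⟩
      obtain ⟨x, y, rfl⟩ := hu n
      exact ⟨x, y * c⁻¹, by rw [smul_smul, inv_mul_cancel_right₀ hc]⟩
  · have hab' : a - b ≠ 0 := sub_ne_zero.2 hab
    refine ⟨u + (c / (a - b)) • v, v, fun n => ?_, .inl ⟨a, b, ?_, hTv⟩⟩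
    · obtain ⟨x, y, rfl⟩ := hu n
      exact ⟨x, y - x * (c / (a - b)), by module⟩
    · rw [map_add, map_smul, hTu, hTv]
      match_scalars
      · ring
      · field_simp
        ring

theorem exists_jordan_triple (hW : Module.finrank ℂ W = 3) (T : Module.End ℂ W) :
    ∃ u v z : W, (∀ n, ∃ a b c : ℂ, n = a • u + b • v + c • z) ∧
      ((∃ a b c : ℂ, T u = a • u ∧ T v = b • v ∧ T z = c • z) ∨
        (∃ a b : ℂ, T u = a • u + v ∧ T v = a • v ∧ T z = b • z) ∨
        ∃ a : ℂ, T u = a • u + v ∧ T v = a • v + z ∧ T z = a • z) := by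
  have : FiniteDimensional ℂ W := Module.finite_of_finrank_pos (by omega)
  have : Nontrivial W := Module.nontrivial_of_finrank_pos (R := ℂ) (by omega)
  obtain ⟨c, hc⟩ := Module.End.exists_eigenvalue T
  obtain ⟨z, hz⟩ := hc.exists_hasEigenvector
  have hTz : T z = c • z := hz.apply_eq_smul
  -- A Jordan basis of the quotient by the line of an eigenvector `z` is lifted and corrected.
  let Z : Submodule ℂ W := Submodule.span ℂ {z}
  have hZ : Module.finrank ℂ (W ⧸ Z) = 2 := by
    have h1 := Z.finrank_quotient_add_finrank
    have h2 : Module.finrank ℂ Z = 1 := finrank_span_singleton hz.2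
    omega
  have hTZ : Z ≤ Z.comap T := by
    refine (Submodule.span_singleton_le_iff_mem _ _).2 ?_
    rw [Submodule.mem_comap, hTz]
    exact Z.smul_mem _ (Submodule.mem_span_singleton_self z)
  have lift : ∀ m n : W, (Submodule.Quotient.mk m : W ⧸ Z) = Submodule.Quotient.mk n →
      ∃ t : ℂ, m = n + t • z := fun m n h => by
    obtain ⟨t, ht⟩ := Submodule.mem_span_singleton.1 ((Submodule.Quotient.eq Z).1 h)
    exact ⟨t, by rw [ht]; abel⟩
  obtain ⟨u', v', huv, hcase⟩ := exists_jordan_pair hZ (Z.mapQ Z T hTZ)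
  obtain ⟨u, rfl⟩ := Submodule.Quotient.mk_surjective Z u'
  obtain ⟨v, rfl⟩ := Submodule.Quotient.mk_surjective Z v'
  have hspan : ∀ n, ∃ a b c : ℂ, n = a • u + b • v + c • z := fun n => by
    obtain ⟨a, b, h⟩ := huv (Submodule.Quotient.mk n)
    obtain ⟨t, ht⟩ := lift n (a • u + b • v) h
    exact ⟨a, b, t, ht⟩
  rcases hcase with ⟨a, b, hu, hv⟩ | ⟨a, hu, hv⟩
  · obtain ⟨α, hTu⟩ := lift (T u) (a • u) hu
    obtain ⟨β, hTv⟩ := lift (T v) (b • v) hv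
    -- Off-diagonal terms between different eigenvalues are removed.
    have hred : ∀ (a α : ℂ) (u : W), T u = a • u + α • z →
        ∃ s α' : ℂ, T (u + s • z) = a • (u + s • z) + α' • z ∧ (a = c ∨ α' = 0) := by
      intro a α u hTu
      by_cases hac : a = c
      · exact ⟨0, α, by simpa using hTu, .inl hac⟩
      · have hac' : a - c ≠ 0 := sub_ne_zero.2 hac
        refine ⟨α / (a - c), 0, ?_, .inr rfl⟩
        rw [map_add, map_smul, hTu, hTz]
        match_scalars
        · ring
        · field_simp
          ring
    obtain ⟨s, α', hTu', hα⟩ := hred a α u hTu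
    obtain ⟨t, β', hTv', hβ⟩ := hred b β v hTv
    have hspan' : ∀ n, ∃ x y w : ℂ, n = x • (u + s • z) + y • (v + t • z) + w • z := fun n => by
      obtain ⟨x, y, w, rfl⟩ := hspan n
      exact ⟨x, y, w - x * s - y * t, by module⟩
    generalize u + s • z = u at *
    generalize v + t • z = v at *
    by_cases hα0 : α' = 0
    · by_cases hβ0 : β' = 0
      · exact ⟨u, v, z, hspan', .inl ⟨a, b, c, by simp [hTu', hα0], by simp [hTv', hβ0], hTz⟩⟩
      · have hbc : b = c := hβ.resolve_right hβ0
        refine ⟨v, β' • z, u, fun n => ?_, .inr (.inl ⟨b, a, hTv', ?_, by simp [hTu', hα0]⟩)⟩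
        · obtain ⟨x, y, w, rfl⟩ := hspan' n
          exact ⟨y, w * β'⁻¹, x, by rw [smul_smul, inv_mul_cancel_right₀ hβ0]; abel⟩
        · rw [map_smul, hTz, hbc, smul_comm]
    · have hac : a = c := hα.resolve_right hα0
      refine ⟨u, α' • z, v - (β' / α') • u, fun n => ?_, .inr (.inl ⟨a, b, hTu', ?_, ?_⟩)⟩
      · obtain ⟨x, y, w, rfl⟩ := hspan' n
        refine ⟨x + y * (β' / α'), w * α'⁻¹, y, ?_⟩
        rw [smul_smul, inv_mul_cancel_right₀ hα0]
        module
      · rw [map_smul, hTz, hac, smul_comm]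
      · rw [map_sub, map_smul, hTu', hTv']
        rcases hβ with rfl | h
        · subst hac
          match_scalars <;> field_simp
          ring
        · subst h
          simp
  · obtain ⟨α, hTu⟩ := lift (T u) (a • u + v) hu
    obtain ⟨β, hTv⟩ := lift (T v) (a • v) hv
    by_cases hac : a = c
    · subst hac
      have hTv' : T (v + α • z) = a • (v + α • z) + β • z := by
        rw [map_add, map_smul, hTv, hTz]
        module
      have hTu' : T u = a • u + (v + α • z) := by rw [hTu, add_assoc]
      by_cases hβ : β = 0
      · refine ⟨u, v + α • z, z, fun n => ?_, .inr (.inl ⟨a, a, hTu', ?_, hTz⟩)⟩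
        · obtain ⟨x, y, w, rfl⟩ := hspan n
          exact ⟨x, y, w - y * α, by module⟩
        · rw [hTv', hβ, zero_smul, add_zero]
      · refine ⟨u, v + α • z, β • z, fun n => ?_, .inr (.inr ⟨a, hTu', hTv', ?_⟩)⟩
        · obtain ⟨x, y, w, rfl⟩ := hspan n
          refine ⟨x, y, (w - y * α) * β⁻¹, ?_⟩
          rw [smul_smul, inv_mul_cancel_right₀ hβ]
          module
        · rw [map_smul, hTz, smul_comm]
    · have hac' : a - c ≠ 0 := sub_ne_zero.2 hac
      let s := β / (a - c)
      let r := (α - s) / (a - c)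
      have hs : s * (a - c) = β := div_mul_cancel₀ _ hac'
      have hr : r * (a - c) = α - s := div_mul_cancel₀ _ hac'
      refine ⟨u + r • z, v + s • z, z, fun n => ?_, .inr (.inl ⟨a, c, ?_, ?_, hTz⟩)⟩
      · obtain ⟨x, y, w, rfl⟩ := hspan n
        exact ⟨x, y, w - x * r - y * s, by module⟩
      · rw [map_add, map_smul, hTu, hTz]
        match_scalars
        · ring
        · ring
        · linear_combination -hr
      · rw [map_add, map_smul, hTv, hTz]
        match_scalars
        · ring
        · linear_combination -hs

end Jordan

section JordanSubmodule

variable {N : Type*} [AddCommGroup N] [Module ℂ N]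

theorem exists_eigenvector_of_finrank_eq_one {W : Submodule ℂ N} (hW : Module.finrank ℂ W = 1)
    {T : Module.End ℂ N} (hT : ∀ n ∈ W, T n ∈ W) :
    ∃ u ∈ W, u ≠ 0 ∧ (∀ n ∈ W, ∃ a : ℂ, n = a • u) ∧ ∃ a : ℂ, T u = a • u := by
  obtain ⟨u, hu, h⟩ := finrank_eq_one_iff'.1 hW
  have h' : ∀ n ∈ W, ∃ a : ℂ, n = a • (u : N) := fun n hn => by
    obtain ⟨a, ha⟩ := h ⟨n, hn⟩
    exact ⟨a, congrArg Subtype.val ha.symm⟩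
  exact ⟨u, u.2, by simpa using hu, h', h' _ (hT u u.2)⟩

theorem exists_jordan_pair_of_injOn {W : Submodule ℂ N} (hW : Module.finrank ℂ W = 2)
    {T : Module.End ℂ N} (hT : ∀ n ∈ W, T n ∈ W) (hinj : ∀ n ∈ W, T n = 0 → n = 0) :
    ∃ u ∈ W, ∃ v ∈ W, (∀ n ∈ W, ∃ a b : ℂ, n = a • u + b • v) ∧
      ((∃ a b : ℂ, a ≠ 0 ∧ b ≠ 0 ∧ T u = a • u ∧ T v = b • v) ∨
        ∃ a : ℂ, a ≠ 0 ∧ T u = a • (u + v) ∧ T v = a • v) := by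
  obtain ⟨u, v, hs, hc⟩ := exists_jordan_pair hW (T.restrict hT)
  obtain ⟨B, hBu, hBv⟩ := exists_basis_of_span_pair hW hs
  have hs' : ∀ n ∈ W, ∃ a b : ℂ, n = a • (u : N) + b • (v : N) := fun n hn => by
    obtain ⟨a, b, h⟩ := hs ⟨n, hn⟩
    exact ⟨a, b, congrArg Subtype.val h⟩
  have hne : ∀ (a : ℂ) (n : W), n ≠ 0 → T n = a • (n : N) → a ≠ 0 := by
    rintro a n hn h rfl
    exact hn (Subtype.ext (hinj n n.2 (by rw [h, zero_smul])))
  have hv0 : v ≠ 0 := hBv ▸ B.ne_zero 1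
  rcases hc with ⟨a, b, hu, hv⟩ | ⟨a, hu, hv⟩
  · have hu' : T u = a • (u : N) := congrArg Subtype.val hu
    have hv' : T v = b • (v : N) := congrArg Subtype.val hv
    exact ⟨u, u.2, v, v.2, hs', .inl ⟨a, b, hne a u (hBu ▸ B.ne_zero 0) hu', hne b v hv0 hv',
      hu', hv'⟩⟩
  · have hu' : T u = a • (u : N) + v := congrArg Subtype.val hu
    have hv' : T v = a • (v : N) := congrArg Subtype.val hv
    have ha := hne a v hv0 hv'
    refine ⟨u, u.2, a⁻¹ • v, W.smul_mem _ v.2, fun n hn => ?_, .inr ⟨a, ha, ?_, ?_⟩⟩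
    · obtain ⟨x, y, rfl⟩ := hs' n hn
      exact ⟨x, y * a, by rw [smul_smul, mul_inv_cancel_right₀ ha]⟩
    · rw [hu', smul_add, smul_inv_smul₀ ha]
    · rw [map_smul, hv', smul_comm]

theorem exists_jordan_triple_of_injective (hN : Module.finrank ℂ N = 3) {T : Module.End ℂ N}
    (hinj : ∀ n, T n = 0 → n = 0) :
    ∃ u v z : N, (∀ n, ∃ a b c : ℂ, n = a • u + b • v + c • z) ∧
      ((∃ a b c : ℂ, a ≠ 0 ∧ T u = a • u ∧ T v = b • v ∧ T z = c • z) ∨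
        (∃ a b : ℂ, a ≠ 0 ∧ b ≠ 0 ∧ T u = a • (u + v) ∧ T v = a • v ∧ T z = b • z) ∨
        ∃ a : ℂ, a ≠ 0 ∧ T u = a • (u + v) ∧ T v = a • (v + z) ∧ T z = a • z) := by
  obtain ⟨u, v, z, hs, hc⟩ := exists_jordan_triple hN T
  obtain ⟨B, hBu, hBv, hBz⟩ := exists_basis_of_span_triple hN hs
  have hne : ∀ (a : ℂ) (n : N), n ≠ 0 → T n = a • n → a ≠ 0 := by
    rintro a n hn h rfl
    exact hn (hinj n (by rw [h, zero_smul]))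
  rcases hc with ⟨a, b, c, hu, hv, hz⟩ | ⟨a, b, hu, hv, hz⟩ | ⟨a, hu, hv, hz⟩
  · exact ⟨u, v, z, hs, .inl ⟨a, b, c, hne a u (hBu ▸ B.ne_zero 0) hu, hu, hv, hz⟩⟩
  · have ha := hne a v (hBv ▸ B.ne_zero 1) hv
    refine ⟨u, a⁻¹ • v, z, fun n => ?_, .inr (.inl ⟨a, b, ha, hne b z (hBz ▸ B.ne_zero 2) hz,
      ?_, ?_, hz⟩)⟩
    · obtain ⟨x, y, t, rfl⟩ := hs n
      exact ⟨x, y * a, t, by rw [smul_smul, mul_inv_cancel_right₀ ha]⟩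
    · rw [hu, smul_add, smul_inv_smul₀ ha]
    · rw [map_smul, hv, smul_comm]
  · have ha := hne a z (hBz ▸ B.ne_zero 2) hz
    refine ⟨u, a⁻¹ • v, a⁻¹ • a⁻¹ • z, fun n => ?_, .inr (.inr ⟨a, ha, ?_, ?_, ?_⟩)⟩
    · obtain ⟨x, y, t, rfl⟩ := hs n
      refine ⟨x, y * a, t * a * a, ?_⟩
      rw [smul_smul, smul_smul, smul_smul, mul_inv_cancel_right₀ ha,
        mul_inv_cancel_right₀ ha, mul_inv_cancel_right₀ ha]
    · rw [hu, smul_add, smul_inv_smul₀ ha]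
    · rw [map_smul, hv, smul_add, smul_add, smul_inv_smul₀ ha, smul_inv_smul₀ ha, inv_smul_smul₀ ha]
    · rw [map_smul, map_smul, hz, smul_comm a⁻¹ a, smul_comm a⁻¹ a]

end JordanSubmodule

/-! ### Decomposition of the nilradical -/

section Decomposition

variable {N : Type*} [AddCommGroup N] [Module ℂ N]

/-- A decomposition of `N` into three invariant subspaces: `S = -R` on `Ns` and `S = 0` on `Na`,
where `R` is injective, and `R` is nilpotent on `N₀`; nilpotency is expressed by `0` being the only
eigenvalue. The vector `w` has been moved into `N₀`. -/
structure Decomposition (R S : Module.End ℂ N) (w : N) (Ns Na N₀ : Submodule ℂ N) : Prop where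
  map_s : ∀ n ∈ Ns, R n ∈ Ns
  map_a : ∀ n ∈ Na, R n ∈ Na
  map_R : ∀ n ∈ N₀, R n ∈ N₀
  map_S : ∀ n ∈ N₀, S n ∈ N₀
  S_s : ∀ n ∈ Ns, S n = -R n
  S_a : ∀ n ∈ Na, S n = 0
  inj_s : ∀ n ∈ Ns, R n = 0 → n = 0
  inj_a : ∀ n ∈ Na, R n = 0 → n = 0
  nil : ∀ n ∈ N₀, n ≠ 0 → ∀ a : ℂ, R n = a • n → a = 0
  exists_add : ∀ n, ∃ s ∈ Ns, ∃ a ∈ Na, ∃ z ∈ N₀, n = s + a + z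
  finrank : Module.finrank ℂ Ns + Module.finrank ℂ Na + Module.finrank ℂ N₀ =
    Module.finrank ℂ N
  w_mem : w ∈ N₀
  S_w : S w = 0

/-- The Fitting decomposition of `R`, whose invertible part splits further since there
`S (S + R) = 0` and the difference of the two factors is invertible. -/
theorem exists_decomposition [FiniteDimensional ℂ N] {R S : Module.End ℂ N} {w : N}
    (hRS : ∀ n, R (S n) = S (R n)) (hSS : ∀ n, S (S n) = -S (R n)) (hSw : S w = 0)
    (hR : ¬ IsNilpotent R) :
    ∃ (n₀ : N) (Ns Na N₀ : Submodule ℂ N), Decomposition R S (w + (R n₀ + S n₀)) Ns Na N₀ ∧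
      N₀ ≠ ⊤ := by
  obtain ⟨k, hk, hk0⟩ :=
    ((LinearMap.eventually_isCompl_ker_pow_range_pow R).and (Filter.eventually_gt_atTop 0)).exists
  set N₀ := (R ^ k).ker with hN₀
  set N₁ := (R ^ k).range with hN₁
  have hdisj : ∀ n, n ∈ N₀ → n ∈ N₁ → n = 0 := fun n h h' => by
    simpa using hk.disjoint.le_bot ⟨h, h'⟩
  have hcomm : ∀ n, (R ^ k) (R n) = R ((R ^ k) n) := fun n => by
    rw [← Module.End.mul_apply, ← pow_succ, pow_succ', Module.End.mul_apply]
  have hcommS : ∀ n, (R ^ k) (S n) = S ((R ^ k) n) := fun n => by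
    have : Commute R S := LinearMap.ext hRS
    exact LinearMap.congr_fun (this.pow_left k).eq n
  have hR0 : ∀ n ∈ N₀, R n ∈ N₀ := fun n hn => by
    rw [hN₀, LinearMap.mem_ker] at *
    rw [hcomm, hn, map_zero]
  have hS0 : ∀ n ∈ N₀, S n ∈ N₀ := fun n hn => by
    rw [hN₀, LinearMap.mem_ker] at *
    rw [hcommS, hn, map_zero]
  have hR1 : ∀ n ∈ N₁, R n ∈ N₁ := by
    rintro - ⟨n, rfl⟩
    exact ⟨R n, hcomm n⟩
  have hS1 : ∀ n ∈ N₁, S n ∈ N₁ := by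
    rintro - ⟨n, rfl⟩
    exact ⟨S n, hcommS n⟩
  have hinj : ∀ n ∈ N₁, R n = 0 → n = 0 := fun n hn h => by
    refine hdisj n ?_ hn
    obtain ⟨j, rfl⟩ := Nat.exists_eq_succ_of_ne_zero hk0.ne'
    rw [hN₀, LinearMap.mem_ker, pow_succ, Module.End.mul_apply, h, map_zero]
  have hadd : ∀ n, ∃ z ∈ N₀, ∃ y ∈ N₁, z + y = n := fun n => by
    simpa using Submodule.mem_sup.1 (hk.sup_eq_top ▸ (trivial : n ∈ (⊤ : Submodule ℂ N)))
  have hsurj : ∀ n ∈ N₁, ∃ m ∈ N₁, R m = n := by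
    rintro - ⟨n, rfl⟩
    obtain ⟨z, hz, y, hy, rfl⟩ := hadd n
    obtain ⟨j, rfl⟩ := Nat.exists_eq_succ_of_ne_zero hk0.ne'
    have hpow : ∀ i, (R ^ i) y ∈ N₁ := fun i => by
      induction i with
      | zero => exact hy
      | succ i ih =>
        rw [pow_succ', Module.End.mul_apply]
        exact hR1 _ ih
    refine ⟨(R ^ j) y, hpow j, ?_⟩
    rw [map_add, LinearMap.mem_ker.1 hz, zero_add, pow_succ', Module.End.mul_apply]
  -- The component `w₁ = R m` of `w` in the invertible part is killed by `S`, hence so is `m`, and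
  -- `w₁ = (R + S) m` is removed by the shift `-m`.
  obtain ⟨w₀, hw₀, w₁, hw₁, hw⟩ := hadd w
  have hSw' : S w₀ = -S w₁ := by
    rw [← hw, map_add] at hSw
    exact eq_neg_of_add_eq_zero_left hSw
  have hSw₁ : S w₁ = 0 := hdisj _ (by
    rw [← neg_neg (S w₁), ← hSw']
    exact N₀.neg_mem (hS0 _ hw₀)) (hS1 _ hw₁)
  obtain ⟨m, hm, hRm⟩ := hsurj w₁ hw₁
  have hSm : S m = 0 := hinj _ (hS1 m hm) (by rw [hRS, hRm, hSw₁])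
  have hw' : w + (R (-m) + S (-m)) = w₀ := by
    rw [map_neg, map_neg, hSm, hRm, ← hw]
    abel
  refine ⟨-m, N₁ ⊓ (R + S).ker, N₁ ⊓ S.ker, N₀, ?_, fun htop => hR ⟨k, ?_⟩⟩
  · have hsup : ∀ n ∈ N₁, ∃ s ∈ N₁ ⊓ (R + S).ker, ∃ a ∈ N₁ ⊓ S.ker, n = s + a := by
      intro n hn
      obtain ⟨m, hm, rfl⟩ := hsurj n hn
      refine ⟨-S m, ⟨N₁.neg_mem (hS1 m hm), ?_⟩, R m + S m, ⟨N₁.add_mem hn (hS1 m hm), ?_⟩, by abel⟩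
      · rw [SetLike.mem_coe, LinearMap.mem_ker, LinearMap.add_apply, map_neg, map_neg, hSS, hRS]
        abel
      · rw [SetLike.mem_coe, LinearMap.mem_ker, map_add, hSS]
        abel
    have hs : ∀ n ∈ N₁ ⊓ (R + S).ker, S n = -R n := fun n hn =>
      eq_neg_of_add_eq_zero_right (LinearMap.mem_ker.1 hn.2)
    constructor
    · refine fun n hn => ⟨hR1 n hn.1, ?_⟩
      rw [SetLike.mem_coe, LinearMap.mem_ker, LinearMap.add_apply, ← hRS, hs n hn, map_neg,
        add_neg_cancel]
    · refine fun n hn => ⟨hR1 n hn.1, ?_⟩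
      rw [SetLike.mem_coe, LinearMap.mem_ker, ← hRS, LinearMap.mem_ker.1 hn.2, map_zero]
    · exact hR0
    · exact hS0
    · exact hs
    · exact fun n hn => LinearMap.mem_ker.1 hn.2
    · exact fun n hn => hinj n hn.1
    · exact fun n hn => hinj n hn.1
    · intro n hn hn0 a ha
      have hpow : ∀ i, (R ^ i) n = a ^ i • n := fun i => by
        induction i with
        | zero => simp
        | succ i ih => rw [pow_succ', Module.End.mul_apply, ih, map_smul, ha, smul_smul, pow_succ]
      have := hpow k
      rw [LinearMap.mem_ker.1 hn] at this
      exact eq_zero_of_pow_eq_zero ((smul_eq_zero.1 this.symm).resolve_right hn0)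
    · intro n
      obtain ⟨z, hz, y, hy, rfl⟩ := hadd n
      obtain ⟨s, hs, a, ha, rfl⟩ := hsup y hy
      exact ⟨s, hs, a, ha, z, hz, add_comm _ _⟩
    · have h1 : N₁ ⊓ (R + S).ker ⊔ N₁ ⊓ S.ker = N₁ :=
        le_antisymm (sup_le inf_le_left inf_le_left) fun n hn => by
          obtain ⟨s, hs, a, ha, rfl⟩ := hsup n hn
          exact Submodule.add_mem_sup hs ha
      have h2 : N₁ ⊓ (R + S).ker ⊓ (N₁ ⊓ S.ker) = ⊥ := (Submodule.eq_bot_iff _).2 fun n hn => by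
        refine hinj n hn.1.1 ?_
        rw [← neg_eq_zero, ← hs n hn.1]
        exact LinearMap.mem_ker.1 hn.2.2
      have h3 := Submodule.finrank_sup_add_finrank_inf_eq (N₁ ⊓ (R + S).ker) (N₁ ⊓ S.ker)
      rw [h1, h2, finrank_bot] at h3
      have h4 := Submodule.finrank_add_eq_of_isCompl hk
      change Module.finrank ℂ N₀ + Module.finrank ℂ N₁ = _ at h4
      omega
    · rwa [hw']
    · rw [hw', hSw', hSw₁, neg_zero]
  · exact LinearMap.ker_eq_top.1 htop

end Decomposition

/-! ### Existence of a normal form -/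

section Existence

variable {N : Type*} [AddCommGroup N] [Module ℂ N] {R S : Module.End ℂ N} {w : N}

theorem DataEquiv.of_shift {N' : Type*} [AddCommGroup N'] [Module ℂ N'] {R' S' : Module.End ℂ N'}
    {w' : N'} (n₀ : N) (h : DataEquiv R S (w + (R n₀ + S n₀)) R' S' w') :
    DataEquiv R S w R' S' w' := by
  obtain ⟨φ, c, m, hc, hR, hS, hw⟩ := h
  refine ⟨φ, c, m - φ n₀, hc, hR, hS, ?_⟩
  rw [map_add, map_add, hR, hS, ← eq_sub_iff_add_eq] at hw
  rw [hw, map_sub, map_sub]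
  module

/-- The combination of `e₁, e₂, e₃` whose coefficients are the coordinates of `[g, h]` in the
algebra `p`. -/
noncomputable def Label.comb (p : Label) (e₁ e₂ e₃ : N) (g h : Gen) : N :=
  table p g h .e₁ • e₁ + table p g h .e₂ • e₂ + table p g h .e₃ • e₃

/-- The data are those of `p` when `N` has a basis `e₁, e₂, e₃` which together with
`k • (x + n₀)` multiplies according to the table of `p`. -/
theorem dataEquiv_label (p : Label) (hN : Module.finrank ℂ N = 3) {e₁ e₂ e₃ : N}
    (hs : ∀ n, ∃ a b c : ℂ, n = a • e₁ + b • e₂ + c • e₃) {k : ℂ} (hk : k ≠ 0) (n₀ : N)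
    (hR₁ : k • R e₁ = p.comb e₁ e₂ e₃ .e₁ .x) (hR₂ : k • R e₂ = p.comb e₁ e₂ e₃ .e₂ .x)
    (hR₃ : k • R e₃ = p.comb e₁ e₂ e₃ .e₃ .x)
    (hS₁ : k • S e₁ = p.comb e₁ e₂ e₃ .x .e₁) (hS₂ : k • S e₂ = p.comb e₁ e₂ e₃ .x .e₂)
    (hS₃ : k • S e₃ = p.comb e₁ e₂ e₃ .x .e₃)
    (hw : k ^ 2 • (w + (R n₀ + S n₀)) = p.comb e₁ e₂ e₃ .x .x) :
    DataEquiv R S w p.R p.S p.w := by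
  apply DataEquiv.of_shift n₀
  obtain ⟨B, rfl, rfl, rfl⟩ := exists_basis_of_span_triple hN hs
  have hφ : ∀ g h, B.equivFun (p.comb (B 0) (B 1) (B 2) g h) = fun i => table p g h (idx i) :=
    fun g h => funext fun i => by
      fin_cases i <;>
        simp [Label.comb, idx]
  have hcol : ∀ {T : Module.End ℂ N} {T' : Module.End ℂ (Fin 3 → ℂ)},
      (∀ j, B.equivFun (k • T (B j)) = T' (Pi.single j 1)) →
        ∀ n, B.equivFun (T n) = k⁻¹ • T' (B.equivFun n) := by
    intro T T' h n
    have : B.equivFun.toLinearMap ∘ₗ T = k⁻¹ • (T' ∘ₗ B.equivFun.toLinearMap) := B.ext fun j => by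
      have hj := h j
      rw [map_smul] at hj
      simp only [LinearMap.comp_apply, LinearMap.smul_apply, LinearEquiv.coe_coe]
      rw [eq_inv_smul_iff₀ hk, hj]
      congr 1
      ext i
      simp [Pi.single_apply, eq_comm]
    exact LinearMap.congr_fun this n
  refine ⟨B.equivFun, k⁻¹, 0, inv_ne_zero hk, hcol fun j => ?_, hcol fun j => ?_, ?_⟩
  · have : p.R (Pi.single j 1) = fun i => table p (idx j) .x (idx i) := by
      ext i
      simp [Label.R_apply, Pi.single_apply]
    rw [this, ← hφ]
    fin_cases j
    exacts [congrArg _ hR₁, congrArg _ hR₂, congrArg _ hR₃]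
  · have : p.S (Pi.single j 1) = fun i => table p .x (idx j) (idx i) := by
      ext i
      simp [Label.S_apply, Pi.single_apply]
    rw [this, ← hφ]
    fin_cases j
    exacts [congrArg _ hS₁, congrArg _ hS₂, congrArg _ hS₃]
  · rw [map_zero, map_zero, add_zero, smul_zero, add_zero]
    have : p.w = B.equivFun (k ^ 2 • (w + (R n₀ + S n₀))) := by
      rw [hw, hφ]
      rfl
    rw [this, map_smul, smul_smul, ← mul_pow, inv_mul_cancel₀ hk, one_pow, one_smul]

variable {Ns Na N₀ : Submodule ℂ N}

theorem eq_zero_of_mem_of_finrank_eq_zero [FiniteDimensional ℂ N] {W : Submodule ℂ N}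
    (hW : Module.finrank ℂ W = 0) {n : N} (hn : n ∈ W) : n = 0 := by
  rw [Submodule.finrank_eq_zero.1 hW] at hn
  simpa using hn

/-- One of the cases of the distinction by the dimensions of `Ns`, `Na` and `N₀`, which here are
`3, 0, 0`. In each case `x` is rescaled so that one eigenvalue of `R` becomes `1`. -/
theorem Decomposition.exists_label_of_s_three [FiniteDimensional ℂ N]
    (hN : Module.finrank ℂ N = 3) (D : Decomposition R S w Ns Na N₀)
    (hs : Module.finrank ℂ Ns = 3) :
    ∃ p : Label, DataEquiv R S w p.R p.S p.w := by
  have hd := D.finrank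
  have h0 : Module.finrank ℂ N₀ = 0 := by omega
  have htop : ∀ n, n ∈ Ns := Submodule.eq_top_iff'.1 (Submodule.eq_top_of_finrank_eq (by omega))
  have hw : w = 0 := eq_zero_of_mem_of_finrank_eq_zero h0 D.w_mem
  have hS : ∀ n, S n = -R n := fun n => D.S_s n (htop n)
  obtain ⟨u, v, z, hs, ⟨a, b, c, ha, h₁, h₂, h₃⟩ | ⟨a, b, ha, hb, h₁, h₂, h₃⟩ |
    ⟨a, ha, h₁, h₂, h₃⟩⟩ := exists_jordan_triple_of_injective hN fun n => D.inj_s n (htop n)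
  · refine ⟨.L20 (a⁻¹ * b) (a⁻¹ * c), dataEquiv_label _ hN hs (inv_ne_zero ha) 0
      ?_ ?_ ?_ ?_ ?_ ?_ ?_⟩ <;>
      simp [Label.comb, table, v_apply, smul_smul, hS, hw, h₁, h₂, h₃, ha]
  · refine ⟨.L31 (a⁻¹ * b) (by simp [ha, hb]), dataEquiv_label _ hN hs (inv_ne_zero ha) 0
      ?_ ?_ ?_ ?_ ?_ ?_ ?_⟩ <;>
      simp [Label.comb, table, v_apply, smul_smul, hS, hw, h₁, h₂, h₃, ha, sub_eq_add_neg,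
        add_comm]
  · refine ⟨.L42, dataEquiv_label _ hN hs (inv_ne_zero ha) 0
      ?_ ?_ ?_ ?_ ?_ ?_ ?_⟩ <;>
      simp [Label.comb, table, v_apply, smul_smul, hS, hw, h₁, h₂, h₃, ha, sub_eq_add_neg,
        add_comm]

theorem Decomposition.exists_label_of_a_three [FiniteDimensional ℂ N]
    (hN : Module.finrank ℂ N = 3) (D : Decomposition R S w Ns Na N₀)
    (hs : Module.finrank ℂ Na = 3) :
    ∃ p : Label, DataEquiv R S w p.R p.S p.w := by
  have hd := D.finrank
  have h0 : Module.finrank ℂ N₀ = 0 := by omega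
  have htop : ∀ n, n ∈ Na := Submodule.eq_top_iff'.1 (Submodule.eq_top_of_finrank_eq (by omega))
  have hw : w = 0 := eq_zero_of_mem_of_finrank_eq_zero h0 D.w_mem
  have hS : ∀ n, S n = 0 := fun n => D.S_a n (htop n)
  obtain ⟨u, v, z, hs, ⟨a, b, c, ha, h₁, h₂, h₃⟩ | ⟨a, b, ha, hb, h₁, h₂, h₃⟩ |
    ⟨a, ha, h₁, h₂, h₃⟩⟩ := exists_jordan_triple_of_injective hN fun n => D.inj_a n (htop n)
  · refine ⟨.L23 (a⁻¹ * b) (a⁻¹ * c), dataEquiv_label _ hN hs (inv_ne_zero ha) 0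
      ?_ ?_ ?_ ?_ ?_ ?_ ?_⟩ <;>
      simp [Label.comb, table, v_apply, smul_smul, hS, hw, h₁, h₂, h₃, ha]
  · refine ⟨.L32 (a⁻¹ * b), dataEquiv_label _ hN hs (inv_ne_zero ha) 0
      ?_ ?_ ?_ ?_ ?_ ?_ ?_⟩ <;>
      simp [Label.comb, table, v_apply, smul_smul, hS, hw, h₁, h₂, h₃, ha]
  · refine ⟨.L41, dataEquiv_label _ hN hs (inv_ne_zero ha) 0
      ?_ ?_ ?_ ?_ ?_ ?_ ?_⟩ <;>
      simp [Label.comb, table, v_apply, smul_smul, hS, hw, h₁, h₂, h₃, ha]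

theorem Decomposition.exists_label_of_s_two_a_one [FiniteDimensional ℂ N]
    (hN : Module.finrank ℂ N = 3) (D : Decomposition R S w Ns Na N₀) (hs : Module.finrank ℂ Ns = 2)
    (ha : Module.finrank ℂ Na = 1) : ∃ p : Label, DataEquiv R S w p.R p.S p.w := by
  have hd := D.finrank
  have h0 : Module.finrank ℂ N₀ = 0 := by omega
  have hw : w = 0 := eq_zero_of_mem_of_finrank_eq_zero h0 D.w_mem
  obtain ⟨z, hz, hz0, hsa, c, h₃⟩ := exists_eigenvector_of_finrank_eq_one ha D.map_a
  have hc : c ≠ 0 := by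
    rintro rfl
    exact hz0 (D.inj_a z hz (by rw [h₃, zero_smul]))
  obtain ⟨u, hu, v, hv, hss, hcase⟩ := exists_jordan_pair_of_injOn hs D.map_s D.inj_s
  have hsp : ∀ n, ∃ a b c : ℂ, n = a • u + b • v + c • z := fun n => by
    obtain ⟨s, hs, a, ha, y, hy, rfl⟩ := D.exists_add n
    obtain ⟨x, x', rfl⟩ := hss s hs
    obtain ⟨t, rfl⟩ := hsa a ha
    exact ⟨x, x', t, by rw [eq_zero_of_mem_of_finrank_eq_zero h0 hy, add_zero]⟩
  have hSu := D.S_s u hu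
  have hSv := D.S_s v hv
  have hSz := D.S_a z hz
  obtain ⟨a, b, ha, hb, h₁, h₂⟩ | ⟨a, ha, h₁, h₂⟩ := hcase
  · refine ⟨.L21 (a⁻¹ * b) (a⁻¹ * c) (by simp [ha, hc]),
      dataEquiv_label _ hN hsp (inv_ne_zero ha) 0 ?_ ?_ ?_ ?_ ?_ ?_ ?_⟩ <;>
      simp [Label.comb, table, v_apply, smul_smul, hSu, hSv, hSz, hw, h₁, h₂, h₃, ha]
  · refine ⟨.L29 (a⁻¹ * c),
      dataEquiv_label _ hN hsp (inv_ne_zero ha) 0 ?_ ?_ ?_ ?_ ?_ ?_ ?_⟩ <;>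
      simp [Label.comb, table, v_apply, smul_smul, hSu, hSv, hSz, hw, h₁, h₂, h₃, ha,
        sub_eq_add_neg, add_comm]

theorem Decomposition.exists_label_of_s_one_a_two [FiniteDimensional ℂ N]
    (hN : Module.finrank ℂ N = 3) (D : Decomposition R S w Ns Na N₀) (hs : Module.finrank ℂ Ns = 1)
    (ha : Module.finrank ℂ Na = 2) : ∃ p : Label, DataEquiv R S w p.R p.S p.w := by
  have hd := D.finrank
  have h0 : Module.finrank ℂ N₀ = 0 := by omega
  have hw : w = 0 := eq_zero_of_mem_of_finrank_eq_zero h0 D.w_mem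
  obtain ⟨z, hz, hz0, hss, c, h₃⟩ := exists_eigenvector_of_finrank_eq_one hs D.map_s
  have hc : c ≠ 0 := by
    rintro rfl
    exact hz0 (D.inj_s z hz (by rw [h₃, zero_smul]))
  obtain ⟨u, hu, v, hv, hsa, hcase⟩ := exists_jordan_pair_of_injOn ha D.map_a D.inj_a
  have hsp : ∀ n, ∃ a b c : ℂ, n = a • u + b • v + c • z := fun n => by
    obtain ⟨s, hs, a, ha, y, hy, rfl⟩ := D.exists_add n
    obtain ⟨x, x', rfl⟩ := hsa a ha
    obtain ⟨t, rfl⟩ := hss s hs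
    exact ⟨x, x', t, by rw [eq_zero_of_mem_of_finrank_eq_zero h0 hy]; abel⟩
  have hSu := D.S_a u hu
  have hSv := D.S_a v hv
  have hSz := D.S_s z hz
  obtain ⟨a, b, ha, hb, h₁, h₂⟩ | ⟨a, ha, h₁, h₂⟩ := hcase
  · have hsp' : ∀ n, ∃ a b c : ℂ, n = a • z + b • u + c • v := fun n => by
      obtain ⟨x, y, t, rfl⟩ := hsp n
      exact ⟨t, x, y, by abel⟩
    refine ⟨.L22 (c⁻¹ * a) (c⁻¹ * b) (by simp [ha, hc]) (by simp [hb, hc]),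
      dataEquiv_label _ hN hsp' (inv_ne_zero hc) 0 ?_ ?_ ?_ ?_ ?_ ?_ ?_⟩ <;>
      simp [Label.comb, table, v_apply, smul_smul, hSu, hSv, hSz, hw, h₁, h₂, h₃, hc]
  · refine ⟨.L34 (a⁻¹ * c) (by simp [ha, hc]),
      dataEquiv_label _ hN hsp (inv_ne_zero ha) 0 ?_ ?_ ?_ ?_ ?_ ?_ ?_⟩ <;>
      simp [Label.comb, table, v_apply, smul_smul, hSu, hSv, hSz, hw, h₁, h₂, h₃, ha]

/-- On a nilpotent part of dimension one both operators vanish. -/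
theorem Decomposition.exists_generator (D : Decomposition R S w Ns Na N₀)
    (hSS : ∀ n, S (S n) = -S (R n))
    (h0 : Module.finrank ℂ N₀ = 1) :
    ∃ z ∈ N₀, R z = 0 ∧ S z = 0 ∧ (∀ n ∈ N₀, ∃ c : ℂ, n = c • z) ∧
      (w = 0 ∨ ∃ t : ℂ, t ≠ 0 ∧ w = t • z) := by
  obtain ⟨z, hz, hz0, hsz, a, hRz⟩ := exists_eigenvector_of_finrank_eq_one h0 D.map_R
  obtain rfl := D.nil z hz hz0 a hRz
  rw [zero_smul] at hRz
  obtain ⟨b, hSz⟩ := hsz _ (D.map_S z hz)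
  have hb : b = 0 := by
    have := hSS z
    rw [hRz, map_zero, neg_zero, hSz, map_smul, hSz, smul_smul] at this
    exact mul_self_eq_zero.1 ((smul_eq_zero.1 this).resolve_right hz0)
  obtain ⟨t, ht⟩ := hsz w D.w_mem
  refine ⟨z, hz, hRz, by rw [hSz, hb, zero_smul], hsz, ?_⟩
  by_cases h : t = 0
  · exact .inl (by rw [ht, h, zero_smul])
  · exact .inr ⟨t, h, ht⟩

theorem Decomposition.exists_label_of_s_two_nil_one [FiniteDimensional ℂ N]
    (hN : Module.finrank ℂ N = 3) (D : Decomposition R S w Ns Na N₀) (hSS : ∀ n, S (S n) = -S (R n))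
    (hs : Module.finrank ℂ Ns = 2) (h0 : Module.finrank ℂ N₀ = 1) :
    ∃ p : Label, DataEquiv R S w p.R p.S p.w := by
  have hd := D.finrank
  have h0a : Module.finrank ℂ Na = 0 := by omega
  obtain ⟨z, hz, h₃, hSz, hs0, hw⟩ := D.exists_generator hSS h0
  obtain ⟨u, hu, v, hv, hss, hcase⟩ := exists_jordan_pair_of_injOn hs D.map_s D.inj_s
  have hsp : ∀ t : ℂ, t ≠ 0 → ∀ n, ∃ a b c : ℂ, n = a • u + b • v + c • t • z := fun t ht n => by
    obtain ⟨s, hs, a, ha, y, hy, rfl⟩ := D.exists_add n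
    obtain ⟨x, x', rfl⟩ := hss s hs
    obtain ⟨r, rfl⟩ := hs0 y hy
    exact ⟨x, x', r * t⁻¹, by
      rw [eq_zero_of_mem_of_finrank_eq_zero h0a ha, add_zero, smul_smul,
        inv_mul_cancel_right₀ ht]⟩
  have hSu := D.S_s u hu
  have hSv := D.S_s v hv
  obtain ⟨a, b, ha, hb, h₁, h₂⟩ | ⟨a, ha, h₁, h₂⟩ := hcase <;>
    obtain hw | ⟨t, ht, hw⟩ := hw
  · refine ⟨.L20 (a⁻¹ * b) 0, dataEquiv_label _ hN (hsp 1 one_ne_zero) (inv_ne_zero ha) 0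
      ?_ ?_ ?_ ?_ ?_ ?_ ?_⟩ <;>
      simp [Label.comb, table, v_apply, smul_smul, hSu, hSv, hSz, hw, h₁, h₂, h₃, ha]
  · -- The third basis vector `a⁻² w` is the square of the rescaled element `a⁻¹ x`.
    refine ⟨.L24 (a⁻¹ * b), dataEquiv_label _ hN (hsp (a⁻¹ ^ 2 * t) (by simp [ha, ht]))
      (inv_ne_zero ha) 0 ?_ ?_ ?_ ?_ ?_ ?_ ?_⟩ <;>
      simp [Label.comb, table, v_apply, smul_smul, hSu, hSv, hSz, hw, h₁, h₂, h₃, ha]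
  · refine ⟨.L29 0, dataEquiv_label _ hN (hsp 1 one_ne_zero) (inv_ne_zero ha) 0
      ?_ ?_ ?_ ?_ ?_ ?_ ?_⟩ <;>
      simp [Label.comb, table, v_apply, smul_smul, hSu, hSv, hSz, hw, h₁, h₂, h₃, ha,
        sub_eq_add_neg, add_comm]
  · refine ⟨.L30, dataEquiv_label _ hN (hsp (a⁻¹ ^ 2 * t) (by simp [ha, ht]))
      (inv_ne_zero ha) 0 ?_ ?_ ?_ ?_ ?_ ?_ ?_⟩ <;>
      simp [Label.comb, table, v_apply, smul_smul, hSu, hSv, hSz, hw, h₁, h₂, h₃, ha,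
        sub_eq_add_neg, add_comm]

theorem Decomposition.exists_label_of_a_two_nil_one [FiniteDimensional ℂ N]
    (hN : Module.finrank ℂ N = 3) (D : Decomposition R S w Ns Na N₀) (hSS : ∀ n, S (S n) = -S (R n))
    (ha : Module.finrank ℂ Na = 2) (h0 : Module.finrank ℂ N₀ = 1) :
    ∃ p : Label, DataEquiv R S w p.R p.S p.w := by
  have hd := D.finrank
  have h0s : Module.finrank ℂ Ns = 0 := by omega
  obtain ⟨z, hz, h₃, hSz, hs0, hw⟩ := D.exists_generator hSS h0
  obtain ⟨u, hu, v, hv, hsa, hcase⟩ := exists_jordan_pair_of_injOn ha D.map_a D.inj_a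
  have hsp : ∀ t : ℂ, t ≠ 0 → ∀ n, ∃ a b c : ℂ, n = a • u + b • v + c • t • z := fun t ht n => by
    obtain ⟨s, hs, a, ha, y, hy, rfl⟩ := D.exists_add n
    obtain ⟨x, x', rfl⟩ := hsa a ha
    obtain ⟨r, rfl⟩ := hs0 y hy
    exact ⟨x, x', r * t⁻¹, by
      rw [eq_zero_of_mem_of_finrank_eq_zero h0s hs, zero_add, smul_smul,
        inv_mul_cancel_right₀ ht]⟩
  have hSu := D.S_a u hu
  have hSv := D.S_a v hv
  obtain ⟨a, b, ha, hb, h₁, h₂⟩ | ⟨a, ha, h₁, h₂⟩ := hcase <;>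
    obtain hw | ⟨t, ht, hw⟩ := hw
  · refine ⟨.L23 (a⁻¹ * b) 0, dataEquiv_label _ hN (hsp 1 one_ne_zero) (inv_ne_zero ha) 0
      ?_ ?_ ?_ ?_ ?_ ?_ ?_⟩ <;>
      simp [Label.comb, table, v_apply, smul_smul, hSu, hSv, hSz, hw, h₁, h₂, h₃, ha]
  · refine ⟨.L26 (a⁻¹ * b), dataEquiv_label _ hN (hsp (a⁻¹ ^ 2 * t) (by simp [ha, ht]))
      (inv_ne_zero ha) 0 ?_ ?_ ?_ ?_ ?_ ?_ ?_⟩ <;>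
      simp [Label.comb, table, v_apply, smul_smul, hSu, hSv, hSz, hw, h₁, h₂, h₃, ha]
  · refine ⟨.L32 0, dataEquiv_label _ hN (hsp 1 one_ne_zero) (inv_ne_zero ha) 0
      ?_ ?_ ?_ ?_ ?_ ?_ ?_⟩ <;>
      simp [Label.comb, table, v_apply, smul_smul, hSu, hSv, hSz, hw, h₁, h₂, h₃, ha]
  · refine ⟨.L33, dataEquiv_label _ hN (hsp (a⁻¹ ^ 2 * t) (by simp [ha, ht]))
      (inv_ne_zero ha) 0 ?_ ?_ ?_ ?_ ?_ ?_ ?_⟩ <;>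
      simp [Label.comb, table, v_apply, smul_smul, hSu, hSv, hSz, hw, h₁, h₂, h₃, ha]

theorem Decomposition.exists_label_of_s_one_a_one_nil_one [FiniteDimensional ℂ N]
    (hN : Module.finrank ℂ N = 3) (D : Decomposition R S w Ns Na N₀) (hSS : ∀ n, S (S n) = -S (R n))
    (hs : Module.finrank ℂ Ns = 1) (ha : Module.finrank ℂ Na = 1)
    (h0 : Module.finrank ℂ N₀ = 1) : ∃ p : Label, DataEquiv R S w p.R p.S p.w := by
  obtain ⟨z, hz, h₃, hSz, hs0, hw⟩ := D.exists_generator hSS h0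
  obtain ⟨u, hu, hu0, hss, a, h₁⟩ := exists_eigenvector_of_finrank_eq_one hs D.map_s
  obtain ⟨v, hv, hv0, hsa, b, h₂⟩ := exists_eigenvector_of_finrank_eq_one ha D.map_a
  have ha : a ≠ 0 := by
    rintro rfl
    exact hu0 (D.inj_s u hu (by rw [h₁, zero_smul]))
  have hb : b ≠ 0 := by
    rintro rfl
    exact hv0 (D.inj_a v hv (by rw [h₂, zero_smul]))
  have hsp : ∀ n, ∃ a b c : ℂ, n = a • u + b • v + c • z := fun n => by
    obtain ⟨s, hs, a, ha, y, hy, rfl⟩ := D.exists_add n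
    obtain ⟨x, rfl⟩ := hss s hs
    obtain ⟨x', rfl⟩ := hsa a ha
    obtain ⟨r, rfl⟩ := hs0 y hy
    exact ⟨x, x', r, rfl⟩
  have hSu := D.S_s u hu
  have hSv := D.S_a v hv
  obtain hw | ⟨t, ht, hw⟩ := hw
  · have hsp' : ∀ n, ∃ a b c : ℂ, n = a • u + b • z + c • v := fun n => by
      obtain ⟨x, y, t, rfl⟩ := hsp n
      exact ⟨x, t, y, by abel⟩
    refine ⟨.L21 0 (a⁻¹ * b) (by simp [ha, hb]), dataEquiv_label _ hN hsp' (inv_ne_zero ha) 0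
      ?_ ?_ ?_ ?_ ?_ ?_ ?_⟩ <;>
      simp [Label.comb, table, v_apply, smul_smul, hSu, hSv, hSz, hw, h₁, h₂, h₃, ha]
  · have ht' : a⁻¹ ^ 2 * t ≠ 0 := by simp [ha, ht]
    have hsp' : ∀ n, ∃ x y r : ℂ, n = x • u + y • v + r • ((a⁻¹ ^ 2 * t) • z) := fun n => by
      obtain ⟨x, y, r, rfl⟩ := hsp n
      exact ⟨x, y, r * (a⁻¹ ^ 2 * t)⁻¹, by rw [smul_smul, inv_mul_cancel_right₀ ht']⟩
    refine ⟨.L25 (a⁻¹ * b) (by simp [ha, hb]), dataEquiv_label _ hN hsp' (inv_ne_zero ha) 0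
      ?_ ?_ ?_ ?_ ?_ ?_ ?_⟩ <;>
      simp [Label.comb, table, v_apply, smul_smul, hSu, hSv, hSz, hw, h₁, h₂, h₃, ha]

/-- The possible actions on a nilpotent part of dimension two: either `R = S = 0`, or `(R, S)` is
`(0, E)` or `(E, α E)` for a nonzero `E` with `E² = 0`. The vector `w` is normalised modulo the
image of `R + S`. -/
theorem Decomposition.exists_basis_pair (D : Decomposition R S w Ns Na N₀)
    (hRS : ∀ n, R (S n) = S (R n)) (hSS : ∀ n, S (S n) = -S (R n))
    (h0 : Module.finrank ℂ N₀ = 2) {k : ℂ} (hk : k ≠ 0) :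
    ∃ n₀ u v : N, (∀ n ∈ N₀, ∃ a b : ℂ, n = a • u + b • v) ∧ R v = 0 ∧ S v = 0 ∧
      ((R u = 0 ∧ S u = 0 ∧ w + (R n₀ + S n₀) = 0) ∨
        (R u = 0 ∧ S u = 0 ∧ k ^ 2 • (w + (R n₀ + S n₀)) = v) ∨
        (R u = 0 ∧ k • S u = v ∧ w + (R n₀ + S n₀) = 0) ∨
        (∃ α : ℂ, k • R u = v ∧ k • S u = α • v ∧ w + (R n₀ + S n₀) = 0) ∨
        (k • R u = v ∧ k • S u = -v ∧ k ^ 2 • (w + (R n₀ + S n₀)) = v) ∨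
        (k • R u = v ∧ S u = 0 ∧ k ^ 2 • (w + (R n₀ + S n₀)) = u)) := by
  have hpair : ∀ {T : Module.End ℂ N}, (∀ n ∈ N₀, T n ∈ N₀) → (∀ n ∈ N₀, n ≠ 0 → ∀ a : ℂ,
      T n = a • n → a = 0) → ∃ u ∈ N₀, ∃ v ∈ N₀, v ≠ 0 ∧ u ≠ 0 ∧
        (∀ n ∈ N₀, ∃ a b : ℂ, n = a • u + b • v) ∧
        (∀ a b : ℂ, a • u + b • v = 0 → a = 0 ∧ b = 0) ∧ T v = 0 ∧ (T u = 0 ∨ T u = v) := by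
    intro T hT hnil
    obtain ⟨u, v, hs, hc⟩ := exists_jordan_pair h0 (T.restrict hT)
    obtain ⟨B, hBu, hBv⟩ := exists_basis_of_span_pair h0 hs
    have hu0 : (u : N) ≠ 0 := by simpa using hBu ▸ B.ne_zero 0
    have hv0 : (v : N) ≠ 0 := by simpa using hBv ▸ B.ne_zero 1
    refine ⟨u, u.2, v, v.2, hv0, hu0, fun n hn => ?_, fun a b hab => ?_, ?_⟩
    · obtain ⟨a, b, h⟩ := hs ⟨n, hn⟩
      exact ⟨a, b, congrArg Subtype.val h⟩
    · have hli := Fintype.linearIndependent_iff.1 B.linearIndependent ![a, b] (by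
        rw [Fin.sum_univ_two, hBu, hBv]
        exact Subtype.ext hab)
      exact ⟨hli 0, hli 1⟩
    · rcases hc with ⟨a, b, hu, hv⟩ | ⟨a, hu, hv⟩
      · have hu' : T u = a • (u : N) := congrArg Subtype.val hu
        have hv' : T v = b • (v : N) := congrArg Subtype.val hv
        exact ⟨by rw [hv', hnil v v.2 hv0 b hv', zero_smul],
          .inl (by rw [hu', hnil u u.2 hu0 a hu', zero_smul])⟩
      · have hu' : T u = a • (u : N) + v := congrArg Subtype.val hu
        have hv' : T v = a • (v : N) := congrArg Subtype.val hv
        have ha := hnil v v.2 hv0 a hv'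
        exact ⟨by rw [hv', ha, zero_smul], .inr (by rw [hu', ha, zero_smul, zero_add])⟩
  have hk2 : k ^ 2 ≠ 0 := pow_ne_zero 2 hk
  obtain ⟨u, hu, v, hv, hv0, hu0, hs, hli, hRv, hRu⟩ := hpair D.map_R D.nil
  rcases hRu with hRu | hRu
  · -- Here `R = 0` on the nilpotent part, so that `S² = 0` there.
    have hR : ∀ n ∈ N₀, R n = 0 := fun n hn => by
      obtain ⟨a, b, rfl⟩ := hs n hn
      simp [hRu, hRv]
    have hSnil : ∀ n ∈ N₀, n ≠ 0 → ∀ a : ℂ, S n = a • n → a = 0 := fun n hn hn0 a ha => by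
      have := hSS n
      rw [hR n hn, map_zero, neg_zero, ha, map_smul, ha, smul_smul] at this
      exact mul_self_eq_zero.1 ((smul_eq_zero.1 this).resolve_right hn0)
    clear hu hv hv0 hu0 hs hli hRv hRu
    obtain ⟨u, hu, v, hv, hv0, hu0, hs, hli, hSv, hSu⟩ := hpair D.map_S hSnil
    rcases hSu with hSu | hSu
    · have hS : ∀ n ∈ N₀, S n = 0 := fun n hn => by
        obtain ⟨a, b, rfl⟩ := hs n hn
        simp [hSu, hSv]
      by_cases hw0 : w = 0
      · exact ⟨0, u, v, hs, hR v hv, hSv, .inl ⟨hR u hu, hSu, by simp [hw0]⟩⟩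
      · have hv' : k ^ 2 • w ∈ N₀ := N₀.smul_mem _ D.w_mem
        obtain ⟨⟨u', hu'⟩, hs'⟩ := exists_span_pair h0 (v := ⟨k ^ 2 • w, hv'⟩)
          (by simpa [hk] using hw0)
        refine ⟨0, u', k ^ 2 • w, fun n hn => ?_, hR _ hv', hS _ hv',
          .inr (.inl ⟨hR _ hu', hS _ hu', by simp⟩)⟩
        obtain ⟨a, b, h⟩ := hs' ⟨n, hn⟩
        exact ⟨a, b, congrArg Subtype.val h⟩
    · obtain ⟨x, y, hw⟩ := hs w D.w_mem
      have hx : x = 0 := by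
        have := D.S_w
        rw [hw, map_add, map_smul, map_smul, hSu, hSv, smul_zero, add_zero] at this
        exact (smul_eq_zero.1 this).resolve_right hv0
      refine ⟨-(y • u), u, k • v, fun n hn => ?_, ?_, ?_,
        .inr (.inr (.inl ⟨hR u hu, by rw [hSu], ?_⟩))⟩
      · obtain ⟨a, b, rfl⟩ := hs n hn
        exact ⟨a, b * k⁻¹, by rw [smul_smul, inv_mul_cancel_right₀ hk]⟩
      · rw [map_smul, hR v hv, smul_zero]
      · rw [map_smul, hSv, smul_zero]
      · rw [map_neg, map_neg, map_smul, map_smul, hR u hu, hSu, hw, hx]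
        module
  · -- Here `S` commutes with a nonzero nilpotent `R`, so that `S = α R`.
    obtain ⟨x, α, hSu⟩ := hs (S u) (D.map_S u hu)
    have hSv' : S v = x • v := by
      rw [← hRu, ← hRS, hSu, map_add, map_smul, map_smul, hRv, smul_zero, add_zero]
    have hx : x = 0 := by
      have := hSS u
      rw [hRu, hSv', hSu, map_add, map_smul, map_smul, hSu, hSv'] at this
      have h2 := (hli (x * x) (x * α + α * x + x) (by
        rw [← sub_eq_zero] at this
        rw [← this]
        module)).1
      exact mul_self_eq_zero.1 h2
    subst hx
    rw [zero_smul] at hSv'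
    rw [zero_smul, zero_add] at hSu
    obtain ⟨x, y, hw⟩ := hs w D.w_mem
    have hx : x * α = 0 := by
      have := D.S_w
      rw [hw, map_add, map_smul, map_smul, hSu, hSv', smul_zero, add_zero, smul_smul] at this
      exact (smul_eq_zero.1 this).resolve_right hv0
    have hs' : ∀ n ∈ N₀, ∃ a b : ℂ, n = a • u + b • k • v := fun n hn => by
      obtain ⟨a, b, rfl⟩ := hs n hn
      exact ⟨a, b * k⁻¹, by rw [smul_smul, inv_mul_cancel_right₀ hk]⟩
    have hRv' : ∀ t : ℂ, R (t • v) = 0 := fun t => by rw [map_smul, hRv, smul_zero]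
    have hSv : ∀ t : ℂ, S (t • v) = 0 := fun t => by rw [map_smul, hSv', smul_zero]
    by_cases hx0 : x = 0
    · subst hx0
      rw [zero_smul, zero_add] at hw
      by_cases hα : 1 + α = 0
      · obtain rfl : α = -1 := by linear_combination hα
        -- Here `R + S = 0`, and `w` cannot be changed.
        by_cases hy : y = 0
        · subst hy
          refine ⟨0, u, k • v, hs', hRv' k, hSv k, .inr (.inr (.inr (.inl
            ⟨-1, by rw [hRu], by rw [hSu, smul_comm], by simp [hw]⟩)))⟩
        · refine ⟨0, (k * y) • u, (k ^ 2 * y) • v, fun n hn => ?_, hRv' _, hSv _,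
            .inr (.inr (.inr (.inr (.inl ⟨?_, ?_, ?_⟩))))⟩
          · obtain ⟨a, b, rfl⟩ := hs n hn
            refine ⟨a * (k * y)⁻¹, b * (k ^ 2 * y)⁻¹, ?_⟩
            rw [smul_smul, smul_smul, inv_mul_cancel_right₀ (mul_ne_zero hk hy),
              inv_mul_cancel_right₀ (mul_ne_zero hk2 hy)]
          · rw [map_smul, hRu]
            module
          · rw [map_smul, hSu]
            module
          · simp [hw, smul_smul]
      · -- Here `R + S = (1 + α) R` has `w` in its image.
        refine ⟨-((y / (1 + α)) • u), u, k • v, hs', hRv' k, hSv k, .inr (.inr (.inr (.inl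
          ⟨α, by rw [hRu], by rw [hSu, smul_comm], ?_⟩)))⟩
        rw [map_neg, map_neg, map_smul, map_smul, hRu, hSu, hw]
        match_scalars
        field_simp
        ring
    · -- Here `S = 0`, and `w` is a generator of the chain of `R`.
      obtain rfl := (mul_eq_zero.1 hx).resolve_left hx0
      rw [zero_smul] at hSu
      refine ⟨0, k ^ 2 • (x • u + y • v), (k ^ 3 * x) • v, fun n hn => ?_, hRv' _, hSv _,
        .inr (.inr (.inr (.inr (.inr ⟨?_, ?_, by simp [hw]⟩))))⟩
      · obtain ⟨a, b, rfl⟩ := hs n hn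
        refine ⟨a / (k ^ 2 * x), (b - a * y / x) / (k ^ 3 * x), ?_⟩
        match_scalars
        · field_simp
        · field_simp
          ring
      · rw [map_smul, map_add, map_smul, hRu, hRv']
        module
      · rw [map_smul, map_add, map_smul, hSu, hSv]
        simp

theorem Decomposition.exists_label_of_s_one_nil_two [FiniteDimensional ℂ N]
    (hN : Module.finrank ℂ N = 3) (D : Decomposition R S w Ns Na N₀) (hRS : ∀ n, R (S n) = S (R n))
    (hSS : ∀ n, S (S n) = -S (R n)) (h1 : Module.finrank ℂ Ns = 1)
    (h0 : Module.finrank ℂ N₀ = 2) : ∃ p : Label, DataEquiv R S w p.R p.S p.w := by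
  have hd := D.finrank
  have h0a : Module.finrank ℂ Na = 0 := by omega
  obtain ⟨z, hz, hz0, hsz, c, h₁⟩ := exists_eigenvector_of_finrank_eq_one h1 D.map_s
  have hc : c ≠ 0 := by
    rintro rfl
    exact hz0 (D.inj_s z hz (by rw [h₁, zero_smul]))
  have hSz := D.S_s z hz
  obtain ⟨n₀, u, v, hs, hRv, hSv, hcase⟩ := D.exists_basis_pair hRS hSS h0 (inv_ne_zero hc)
  have hsp : ∀ n, ∃ a b c : ℂ, n = a • z + b • u + c • v := fun n => by
    obtain ⟨s, hs', a, ha, y, hy, rfl⟩ := D.exists_add n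
    obtain ⟨r, rfl⟩ := hsz _ hs'
    obtain ⟨x, x', rfl⟩ := hs y hy
    exact ⟨r, x, x', by rw [eq_zero_of_mem_of_finrank_eq_zero h0a ha]; abel⟩
  have hsp' : ∀ n, ∃ a b c : ℂ, n = a • u + b • v + c • z := fun n => by
    obtain ⟨x, y, t, rfl⟩ := hsp n
    exact ⟨y, t, x, by abel⟩
  obtain ⟨hRu, hSu, hw⟩ | ⟨hRu, hSu, hw⟩ | ⟨hRu, hSu, hw⟩ | ⟨α, hRu, hSu, hw⟩ | ⟨hRu, hSu, hw⟩ |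
    ⟨hRu, hSu, hw⟩ := hcase
  · refine ⟨.L20 0 0, dataEquiv_label _ hN hsp (inv_ne_zero hc) n₀
      ?_ ?_ ?_ ?_ ?_ ?_ ?_⟩ <;>
      simp [Label.comb, table, v_apply, hSz, h₁, hRu, hSu, hRv, hSv, hw, hc]
  · rw [smul_add, smul_add, inv_pow] at hw
    refine ⟨.L24 0, dataEquiv_label _ hN hsp (inv_ne_zero hc) n₀
      ?_ ?_ ?_ ?_ ?_ ?_ ?_⟩ <;>
      simp [Label.comb, table, v_apply, hSz, h₁, hRu, hSu, hRv, hSv, hw, hc]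
  · refine ⟨.L27, dataEquiv_label _ hN hsp (inv_ne_zero hc) n₀
      ?_ ?_ ?_ ?_ ?_ ?_ ?_⟩ <;>
      simp [Label.comb, table, v_apply, hSz, h₁, hRu, hSu, hRv, hSv, hw, hc]
  · refine ⟨.L35 α, dataEquiv_label _ hN hsp' (inv_ne_zero hc) n₀
      ?_ ?_ ?_ ?_ ?_ ?_ ?_⟩ <;>
      simp [Label.comb, table, v_apply, hSz, h₁, hRu, hSu, hRv, hSv, hw, hc]
  · rw [smul_add, smul_add, inv_pow] at hw
    refine ⟨.L36, dataEquiv_label _ hN hsp' (inv_ne_zero hc) n₀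
      ?_ ?_ ?_ ?_ ?_ ?_ ?_⟩ <;>
      simp [Label.comb, table, v_apply, hSz, h₁, hRu, hSu, hRv, hSv, hw, hc]
  · rw [smul_add, smul_add, inv_pow] at hw
    refine ⟨.L37, dataEquiv_label _ hN hsp' (inv_ne_zero hc) n₀
      ?_ ?_ ?_ ?_ ?_ ?_ ?_⟩ <;>
      simp [Label.comb, table, v_apply, hSz, h₁, hRu, hSu, hRv, hSv, hw, hc]

theorem Decomposition.exists_label_of_a_one_nil_two [FiniteDimensional ℂ N]
    (hN : Module.finrank ℂ N = 3) (D : Decomposition R S w Ns Na N₀) (hRS : ∀ n, R (S n) = S (R n))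
    (hSS : ∀ n, S (S n) = -S (R n)) (h1 : Module.finrank ℂ Na = 1)
    (h0 : Module.finrank ℂ N₀ = 2) : ∃ p : Label, DataEquiv R S w p.R p.S p.w := by
  have hd := D.finrank
  have h0a : Module.finrank ℂ Ns = 0 := by omega
  obtain ⟨z, hz, hz0, hsz, c, h₁⟩ := exists_eigenvector_of_finrank_eq_one h1 D.map_a
  have hc : c ≠ 0 := by
    rintro rfl
    exact hz0 (D.inj_a z hz (by rw [h₁, zero_smul]))
  have hSz := D.S_a z hz
  obtain ⟨n₀, u, v, hs, hRv, hSv, hcase⟩ := D.exists_basis_pair hRS hSS h0 (inv_ne_zero hc)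
  have hsp : ∀ n, ∃ a b c : ℂ, n = a • z + b • u + c • v := fun n => by
    obtain ⟨s, hs', a, ha, y, hy, rfl⟩ := D.exists_add n
    obtain ⟨r, rfl⟩ := hsz _ ha
    obtain ⟨x, x', rfl⟩ := hs y hy
    exact ⟨r, x, x', by rw [eq_zero_of_mem_of_finrank_eq_zero h0a hs']; abel⟩
  have hsp' : ∀ n, ∃ a b c : ℂ, n = a • u + b • v + c • z := fun n => by
    obtain ⟨x, y, t, rfl⟩ := hsp n
    exact ⟨y, t, x, by abel⟩
  obtain ⟨hRu, hSu, hw⟩ | ⟨hRu, hSu, hw⟩ | ⟨hRu, hSu, hw⟩ | ⟨α, hRu, hSu, hw⟩ | ⟨hRu, hSu, hw⟩ |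
    ⟨hRu, hSu, hw⟩ := hcase
  · refine ⟨.L23 0 0, dataEquiv_label _ hN hsp (inv_ne_zero hc) n₀
      ?_ ?_ ?_ ?_ ?_ ?_ ?_⟩ <;>
      simp [Label.comb, table, v_apply, hSz, h₁, hRu, hSu, hRv, hSv, hw, hc]
  · rw [smul_add, smul_add, inv_pow] at hw
    refine ⟨.L26 0, dataEquiv_label _ hN hsp (inv_ne_zero hc) n₀
      ?_ ?_ ?_ ?_ ?_ ?_ ?_⟩ <;>
      simp [Label.comb, table, v_apply, hSz, h₁, hRu, hSu, hRv, hSv, hw, hc]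
  · refine ⟨.L28, dataEquiv_label _ hN hsp (inv_ne_zero hc) n₀
      ?_ ?_ ?_ ?_ ?_ ?_ ?_⟩ <;>
      simp [Label.comb, table, v_apply, hSz, h₁, hRu, hSu, hRv, hSv, hw, hc]
  · refine ⟨.L38 α, dataEquiv_label _ hN hsp' (inv_ne_zero hc) n₀
      ?_ ?_ ?_ ?_ ?_ ?_ ?_⟩ <;>
      simp [Label.comb, table, v_apply, hSz, h₁, hRu, hSu, hRv, hSv, hw, hc]
  · rw [smul_add, smul_add, inv_pow] at hw
    refine ⟨.L39, dataEquiv_label _ hN hsp' (inv_ne_zero hc) n₀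
      ?_ ?_ ?_ ?_ ?_ ?_ ?_⟩ <;>
      simp [Label.comb, table, v_apply, hSz, h₁, hRu, hSu, hRv, hSv, hw, hc]
  · rw [smul_add, smul_add, inv_pow] at hw
    refine ⟨.L40, dataEquiv_label _ hN hsp' (inv_ne_zero hc) n₀
      ?_ ?_ ?_ ?_ ?_ ?_ ?_⟩ <;>
      simp [Label.comb, table, v_apply, hSz, h₁, hRu, hSu, hRv, hSv, hw, hc]

theorem exists_label_dataEquiv (hN : Module.finrank ℂ N = 3) (hRS : ∀ n, R (S n) = S (R n))
    (hSS : ∀ n, S (S n) = -S (R n)) (hSw : S w = 0) (hR : ¬ IsNilpotent R) :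
    ∃ p : Label, DataEquiv R S w p.R p.S p.w := by
  have : FiniteDimensional ℂ N := Module.finite_of_finrank_pos (by omega)
  obtain ⟨n₀, Ns, Na, N₀, D, htop⟩ := exists_decomposition hRS hSS hSw hR
  suffices h : ∃ p : Label, DataEquiv R S (w + (R n₀ + S n₀)) p.R p.S p.w from
    h.imp fun p hp => hp.of_shift n₀
  have hd := D.finrank
  have h0 := Submodule.finrank_lt htop
  obtain h | h | h | h | h | h | h | h | h :
      Module.finrank ℂ Ns = 3 ∨ Module.finrank ℂ Na = 3 ∨
      (Module.finrank ℂ Ns = 2 ∧ Module.finrank ℂ Na = 1) ∨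
      (Module.finrank ℂ Ns = 1 ∧ Module.finrank ℂ Na = 2) ∨
      (Module.finrank ℂ Ns = 2 ∧ Module.finrank ℂ N₀ = 1) ∨
      (Module.finrank ℂ Na = 2 ∧ Module.finrank ℂ N₀ = 1) ∨
      (Module.finrank ℂ Ns = 1 ∧ Module.finrank ℂ Na = 1 ∧ Module.finrank ℂ N₀ = 1) ∨
      (Module.finrank ℂ Ns = 1 ∧ Module.finrank ℂ N₀ = 2) ∨
      (Module.finrank ℂ Na = 1 ∧ Module.finrank ℂ N₀ = 2) := by omega
  · exact D.exists_label_of_s_three hN h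
  · exact D.exists_label_of_a_three hN h
  · exact D.exists_label_of_s_two_a_one hN h.1 h.2
  · exact D.exists_label_of_s_one_a_two hN h.1 h.2
  · exact D.exists_label_of_s_two_nil_one hN hSS h.1 h.2
  · exact D.exists_label_of_a_two_nil_one hN hSS h.1 h.2
  · exact D.exists_label_of_s_one_a_one_nil_one hN hSS h.1 h.2.1 h.2.2
  · exact D.exists_label_of_s_one_nil_two hN hRS hSS h.1 h.2
  · exact D.exists_label_of_a_one_nil_two hN hRS hSS h.1 h.2

theorem IsSolvableWithAbelianNilradical.exists_label {L : Type*} [AddCommGroup L] [Module ℂ L]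
    {b : L →ₗ[ℂ] L →ₗ[ℂ] L} (h : IsSolvableWithAbelianNilradical b) :
    ∃ p : Label, Isomorphic b (algebra p) := by
  obtain ⟨N, R, S, w, hN, hRS, hSS, hSw, hR, hiso⟩ := h.exists_extBracket
  obtain ⟨p, hp⟩ := exists_label_dataEquiv hN hRS hSS hSw hR
  exact ⟨p, hiso.trans (hp.isomorphic.trans (algebra_isomorphic p).symm)⟩

end Existence

/-! ### Invariants of the data -/

section Invariants

variable {N : Type*} [AddCommGroup N] [Module ℂ N] {N' : Type*} [AddCommGroup N'] [Module ℂ N']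
variable {R S : Module.End ℂ N} {w : N} {R' S' : Module.End ℂ N'} {w' : N'}

/-- The element `x` can be chosen with `[x, x] = 0`. -/
def SquareRemovable (R S : Module.End ℂ N) (w : N) : Prop := ∃ n, w = R n + S n

/-- `T` has a Jordan chain of length two. -/
def HasJordanPair (T : Module.End ℂ N) : Prop :=
  ∃ (v : N) (a : ℂ), T v - a • v ≠ 0 ∧ T (T v - a • v) = a • (T v - a • v)

/-- `T` has a Jordan chain of length three. -/
def HasJordanTriple (T : Module.End ℂ N) : Prop :=
  ∃ (u v : N) (a : ℂ), T v = a • v + u ∧ T u - a • u ≠ 0 ∧ T (T u - a • u) = a • (T u - a • u)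

/-- `R` has a nilpotent Jordan chain `v ↦ R v ↦ 0` on which `S` is `α R`. -/
def HasNilpotentPair (R S : Module.End ℂ N) (α : ℂ) : Prop :=
  ∃ v, R v ≠ 0 ∧ R (R v) = 0 ∧ S v = α • R v

/-- `S` does not vanish on the kernel of `R`. -/
def ActsOnKer (R S : Module.End ℂ N) : Prop := ∃ v, R v = 0 ∧ S v ≠ 0

theorem DataEquiv.squareRemovable (h : DataEquiv R S w R' S' w') (hw : SquareRemovable R S w) :
    SquareRemovable R' S' w' := by
  obtain ⟨φ, c, n₀, hc, hR, hS, hφ⟩ := h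
  obtain ⟨n, rfl⟩ := hw
  rw [map_add, hR, hS, ← sub_eq_iff_eq_add] at hφ
  refine ⟨c⁻¹ • (φ n - n₀), ?_⟩
  rw [← smul_right_inj (pow_ne_zero 2 hc), ← hφ]
  simp only [map_smul, map_sub]
  match_scalars <;> field_simp

theorem DataEquiv.hasJordanPair (h : DataEquiv R S w R' S' w') (hp : HasJordanPair R) :
    HasJordanPair R' := by
  obtain ⟨φ, c, n₀, hc, hR, -, -⟩ := h
  obtain ⟨v, a, h₁, h₂⟩ := hp
  have hR' : ∀ n, R' (φ n) = c⁻¹ • φ (R n) := fun n => by rw [hR, inv_smul_smul₀ hc]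
  have h₃ : R' (φ v) - (c⁻¹ * a) • φ v = c⁻¹ • φ (R v - a • v) := by
    rw [hR', mul_smul, ← smul_sub, map_sub, map_smul]
  refine ⟨φ v, c⁻¹ * a, ?_, ?_⟩
  · rw [h₃]
    exact smul_ne_zero (inv_ne_zero hc) ((LinearEquiv.map_ne_zero_iff φ).2 h₁)
  · rw [h₃, map_smul, hR', h₂, map_smul, mul_smul, smul_comm a]

theorem DataEquiv.hasJordanTriple (h : DataEquiv R S w R' S' w') (hp : HasJordanTriple R) :
    HasJordanTriple R' := by
  obtain ⟨φ, c, n₀, hc, hR, -, -⟩ := h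
  obtain ⟨u, v, a, h₀, h₁, h₂⟩ := hp
  have hR' : ∀ n, R' (φ n) = c⁻¹ • φ (R n) := fun n => by rw [hR, inv_smul_smul₀ hc]
  have h₃ : R' (c⁻¹ • φ u) - (c⁻¹ * a) • c⁻¹ • φ u = c⁻¹ • c⁻¹ • φ (R u - a • u) := by
    rw [map_smul, hR', map_sub, map_smul]
    module
  refine ⟨c⁻¹ • φ u, φ v, c⁻¹ * a, ?_, ?_, ?_⟩
  · rw [hR', h₀, map_add, map_smul, smul_add, smul_smul]
  · rw [h₃]
    exact smul_ne_zero (inv_ne_zero hc) (smul_ne_zero (inv_ne_zero hc)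
      ((LinearEquiv.map_ne_zero_iff φ).2 h₁))
  · rw [h₃, map_smul, map_smul, hR', h₂, map_smul]
    module

theorem DataEquiv.hasNilpotentPair (h : DataEquiv R S w R' S' w') {α : ℂ}
    (hp : HasNilpotentPair R S α) : HasNilpotentPair R' S' α := by
  obtain ⟨φ, c, n₀, hc, hR, hS, -⟩ := h
  obtain ⟨v, h₀, h₁, h₂⟩ := hp
  have hR' : ∀ n, R' (φ n) = c⁻¹ • φ (R n) := fun n => by rw [hR, inv_smul_smul₀ hc]
  have hS' : ∀ n, S' (φ n) = c⁻¹ • φ (S n) := fun n => by rw [hS, inv_smul_smul₀ hc]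
  refine ⟨φ v, ?_, ?_, ?_⟩
  · rw [hR']
    exact smul_ne_zero (inv_ne_zero hc) ((LinearEquiv.map_ne_zero_iff φ).2 h₀)
  · rw [hR', map_smul, hR', h₁, map_zero, smul_zero, smul_zero]
  · rw [hS', hR', h₂, map_smul, smul_comm]

theorem DataEquiv.actsOnKer (h : DataEquiv R S w R' S' w') (hp : ActsOnKer R S) :
    ActsOnKer R' S' := by
  obtain ⟨φ, c, n₀, hc, hR, hS, -⟩ := h
  obtain ⟨v, h₀, h₁⟩ := hp
  refine ⟨φ v, ?_, fun h => h₁ ?_⟩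
  · have := hR v
    rw [h₀, map_zero] at this
    exact (smul_eq_zero.1 this.symm).resolve_left hc
  · have := hS v
    rwa [h, smul_zero, LinearEquiv.map_eq_zero_iff] at this

end Invariants

theorem Label.squareRemovable_iff (p : Label) :
    SquareRemovable p.R p.S p.w ↔ p.family ∉ [24, 25, 26, 30, 33, 36, 37, 39, 40] := by
  cases p
  case L24 | L25 | L26 | L30 | L33 | L36 | L37 | L39 | L40 =>
    simp only [Label.family, SquareRemovable]
    simp [funext_iff, Fin.forall_fin_succ, Label.R_apply, Label.S_apply, Label.w,
      Fin.sum_univ_three, idx, table, v_apply]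
    try grind
  all_goals
    simp only [Label.family, SquareRemovable]
    simp only [List.mem_cons, List.not_mem_nil]
    norm_num
    exact ⟨0, by
      ext i
      fin_cases i <;> simp [Label.w, table]⟩

/-- In the families 20 to 28 the operator `R` is diagonal. -/
theorem Label.R_apply_of_le_28 {p : Label} (hp : p.family ≤ 28) :
    ∃ d : Fin 3 → ℂ, ∀ u i, p.R u i = d i * u i := by
  refine ⟨fun i => table p (idx i) .x (idx i), fun u i => ?_⟩
  cases p <;> first
    | (exfalso; revert hp; simp [Label.family]; done)
    | (fin_cases i <;> simp [Label.R_apply, Fin.sum_univ_three, idx, table, v_apply])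

/-- In the families 29 to 34 the operator `R` has a Jordan block of size two for the eigenvalue
`1`. -/
theorem Label.R_apply_of_le_34 {p : Label} (hp : 29 ≤ p.family ∧ p.family ≤ 34) :
    ∃ μ : ℂ, ∀ u, p.R u = ![u 0, u 0 + u 1, μ * u 2] := by
  refine ⟨table p .e₃ .x .e₃, fun u => funext fun i => ?_⟩
  cases p <;> first
    | (exfalso; revert hp; simp [Label.family]; done)
    | (fin_cases i <;> simp [Label.R_apply, Fin.sum_univ_three, idx, table, v_apply])

/-- In the families 35 to 40 the operator `R` has a nilpotent Jordan block of size two. -/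
theorem Label.R_apply_of_le_40 {p : Label} (hp : 35 ≤ p.family ∧ p.family ≤ 40) (u : Fin 3 → ℂ) :
    p.R u = ![0, u 0, u 2] := by
  ext i
  cases p <;> first
    | (exfalso; revert hp; simp [Label.family]; done)
    | (fin_cases i <;> simp [Label.R_apply, Fin.sum_univ_three, idx, table, v_apply])

/-- In the families 41 and 42 the operator `R` is a single Jordan block. -/
theorem Label.R_apply_of_41_le {p : Label} (hp : 41 ≤ p.family) (u : Fin 3 → ℂ) :
    p.R u = ![u 0, u 0 + u 1, u 1 + u 2] := by
  ext i
  cases p <;> first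
    | (exfalso; revert hp; simp [Label.family]; done)
    | (fin_cases i <;> simp [Label.R_apply, Fin.sum_univ_three, idx, table, v_apply])

theorem Label.hasJordanPair_iff (p : Label) : HasJordanPair p.R ↔ 29 ≤ p.family := by
  constructor
  · rintro ⟨v, a, hne, h⟩
    -- A diagonal operator has no Jordan chain of length two.
    by_contra hp
    obtain ⟨d, hd⟩ := Label.R_apply_of_le_28 (p := p) (by omega)
    refine hne (funext fun i => ?_)
    have hi := congrFun h i
    simp only [hd, Pi.sub_apply, Pi.smul_apply, smul_eq_mul, Pi.zero_apply] at hi ⊢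
    have : (d i * v i - a * v i) * (d i * v i - a * v i) = 0 := by linear_combination v i * hi
    exact mul_self_eq_zero.1 this
  · intro hp
    have h : (29 ≤ p.family ∧ p.family ≤ 34) ∨ (35 ≤ p.family ∧ p.family ≤ 40) ∨
      41 ≤ p.family := by omega
    rcases h with h | h | h
    · obtain ⟨μ, hR⟩ := Label.R_apply_of_le_34 h
      refine ⟨![1, 0, 0], 1, fun h => ?_, ?_⟩
      · simpa [hR] using congrFun h 1
      · simp [hR]
    · have hR := Label.R_apply_of_le_40 h
      refine ⟨![1, 0, 0], 0, fun h => ?_, ?_⟩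
      · simpa [hR] using congrFun h 1
      · simp [hR]
    · have hR := Label.R_apply_of_41_le h
      refine ⟨![0, 1, 0], 1, fun h => ?_, ?_⟩
      · simpa [hR] using congrFun h 2
      · simp [hR]

theorem Label.hasJordanTriple_iff (p : Label) : HasJordanTriple p.R ↔ 41 ≤ p.family := by
  constructor
  · rintro ⟨u, v, a, hv, hne, h⟩
    by_contra hp
    have h29 := p.hasJordanPair_iff.1 ⟨u, a, hne, h⟩
    apply hne
    have hc : (29 ≤ p.family ∧ p.family ≤ 34) ∨ (35 ≤ p.family ∧ p.family ≤ 40) := by omega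
    rcases hc with hc | hc
    · obtain ⟨μ, hR⟩ := Label.R_apply_of_le_34 hc
      simp only [hR, funext_iff, Fin.forall_fin_succ, IsEmpty.forall_iff, Pi.sub_apply,
        Pi.smul_apply, Pi.add_apply, smul_eq_mul, Pi.zero_apply, Matrix.cons_val_zero,
        Fin.succ_zero_eq_one, Matrix.cons_val_one, Matrix.cons_val, Fin.succ_one_eq_two] at *
      grind
    · have hR := Label.R_apply_of_le_40 hc
      simp only [hR, funext_iff, Fin.forall_fin_succ, IsEmpty.forall_iff, Pi.sub_apply,
        Pi.smul_apply, Pi.add_apply, smul_eq_mul, Pi.zero_apply, Matrix.cons_val_zero,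
        Fin.succ_zero_eq_one, Matrix.cons_val_one, Matrix.cons_val, Fin.succ_one_eq_two] at *
      grind
  · intro hp
    have hR := Label.R_apply_of_41_le hp
    refine ⟨![0, 1, 0], ![1, 0, 0], 1, ?_, fun h => ?_, ?_⟩
    · simp [hR]
    · simpa [hR] using congrFun h 2
    · simp [hR]

theorem Label.hasNilpotentPair_iff (p : Label) (α : ℂ) : HasNilpotentPair p.R p.S α ↔
    (35 ≤ p.family ∧ p.family ≤ 40) ∧ table p .x .e₁ .e₂ = α := by
  have hS : 35 ≤ p.family ∧ p.family ≤ 40 →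
      ∃ t : ℂ, ∀ u, p.S u = ![0, table p .x .e₁ .e₂ * u 0, t * u 2] := fun hp => by
    refine ⟨table p .x .e₃ .e₃, fun u => funext fun i => ?_⟩
    cases p <;> first
      | (exfalso; revert hp; simp [Label.family]; done)
      | (fin_cases i <;> simp [Label.S_apply, Fin.sum_univ_three, idx, table, v_apply])
  constructor
  · rintro ⟨v, h₀, h₁, h₂⟩
    have h29 := p.hasJordanPair_iff.1 ⟨v, 0, by simpa using h₀, by simpa using h₁⟩
    have hp : 35 ≤ p.family ∧ p.family ≤ 40 := by
      by_contra hcon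
      apply h₀
      have h : (29 ≤ p.family ∧ p.family ≤ 34) ∨ 41 ≤ p.family := by omega
      rcases h with h | h
      · obtain ⟨μ, hR⟩ := Label.R_apply_of_le_34 h
        simp [hR] at h₁ ⊢
        grind
      · have hR := Label.R_apply_of_41_le h
        simp [hR] at h₁ ⊢
        grind
    refine ⟨hp, ?_⟩
    have hR := Label.R_apply_of_le_40 hp
    obtain ⟨t, hS⟩ := hS hp
    simp [hR] at h₀ h₁
    have h₃ := congrFun h₂ 1
    simp [hR, hS] at h₃
    grind
  · rintro ⟨hp, rfl⟩
    have hR := Label.R_apply_of_le_40 hp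
    obtain ⟨t, hS⟩ := hS hp
    refine ⟨![1, 0, 0], fun h => ?_, ?_, ?_⟩
    · simpa [hR] using congrFun h 1
    · simp [hR]
    · simp [hR, hS]

theorem Label.actsOnKer_iff {p : Label} (hp : p.family ≤ 28) :
    ActsOnKer p.R p.S ↔ 27 ≤ p.family := by
  constructor
  · rintro ⟨v, h₀, h₁⟩
    by_contra h27
    apply h₁
    ext i
    have h2 := congrFun h₀ i
    cases p <;> first
      | (exfalso; revert hp h27; simp [Label.family]; done)
      | (fin_cases i <;>
          simp_all [Label.R_apply, Label.S_apply, Fin.sum_univ_three, idx, table, v_apply])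
  · intro h27
    refine ⟨![0, 1, 0], ?_, fun h => ?_⟩
    · ext i
      cases p <;> first
        | (exfalso; revert hp h27; simp [Label.family]; done)
        | (fin_cases i <;> simp [Label.R_apply, Fin.sum_univ_three, idx, table, v_apply])
    · have h2 := congrFun h 2
      cases p <;> first
        | (exfalso; revert hp h27; simp [Label.family]; done)
        | (revert h2; simp [Label.S_apply, Fin.sum_univ_three, idx, table, v_apply])

/-! ### Eigenvalues -/

open Polynomial in
theorem charpoly_roots_of_lower {M : Matrix (Fin 3) (Fin 3) ℂ} (hM : ∀ i j, i < j → M i j = 0) :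
    M.charpoly.roots = {M 0 0, M 1 1, M 2 2} := by
  have h : M.transpose.charpoly = ∏ i, (X - C (M i i)) :=
    Matrix.charpoly_of_isUpperTriangular _ fun i j hij => hM j i hij
  rw [Matrix.charpoly_transpose] at h
  have h' : M.charpoly = (({M 0 0, M 1 1, M 2 2} : Multiset ℂ).map fun a => X - C a).prod := by
    rw [h, Fin.prod_univ_three]
    simp [mul_assoc]
  rw [h', roots_multiset_prod_X_sub_C]

/-- Lower triangular matrices which are intertwined up to a factor `c` have the same diagonal up to
the factor and the order. -/
theorem diagonal_eq_of_intertwine {A B : Matrix (Fin 3) (Fin 3) ℂ}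
    (hA : ∀ i j, i < j → A i j = 0) (hB : ∀ i j, i < j → B i j = 0)
    (φ : (Fin 3 → ℂ) ≃ₗ[ℂ] (Fin 3 → ℂ)) {c : ℂ}
    (h : ∀ n, φ (A.mulVecLin n) = c • B.mulVecLin (φ n)) :
    ({A 0 0, A 1 1, A 2 2} : Multiset ℂ) = {c * B 0 0, c * B 1 1, c * B 2 2} := by
  have h1 : φ.conj A.mulVecLin = (c • B).mulVecLin := by
    refine LinearMap.ext fun n => ?_
    rw [LinearEquiv.conj_apply_apply, h, φ.apply_symm_apply]
    simp
  have h2 := φ.charpoly_conj A.mulVecLin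
  rw [h1, Matrix.charpoly_mulVecLin, Matrix.charpoly_mulVecLin] at h2
  rw [← charpoly_roots_of_lower hA, ← h2, charpoly_roots_of_lower]
  · rfl
  · intro i j hij
    rw [Matrix.smul_apply, hB i j hij, smul_zero]

theorem triple_symm_eq {a b c x y z : ℂ} (h : ({a, b, c} : Multiset ℂ) = {x, y, z}) :
    a + b + c = x + y + z ∧ a * b + a * c + b * c = x * y + x * z + y * z ∧
      a * b * c = x * y * z := by
  have h1 := congrArg Multiset.sum h
  have h2 := congrArg (fun s : Multiset ℂ => (s.map (· ^ 2)).sum) h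
  have h3 := congrArg Multiset.prod h
  simp only [Multiset.insert_eq_cons, Multiset.sum_cons, Multiset.sum_singleton,
    Multiset.prod_cons, Multiset.prod_singleton, Multiset.map_cons, Multiset.map_singleton]
    at h1 h2 h3
  refine ⟨by linear_combination h1, ?_, by linear_combination h3⟩
  linear_combination (a + b + c + x + y + z) / 2 * h1 - h2 / 2

theorem pair_eq_of_add_of_mul {a b x y : ℂ} (h1 : a + b = x + y) (h2 : a * b = x * y) :
    ({a, b} : Multiset ℂ) = {x, y} := by
  have h : (a - x) * (a - y) = 0 := by linear_combination a * h1 - h2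
  rcases mul_eq_zero.1 h with h | h
  · obtain rfl := sub_eq_zero.1 h
    rw [add_left_cancel h1]
  · obtain rfl := sub_eq_zero.1 h
    rw [add_comm x] at h1
    rw [add_left_cancel h1, Multiset.pair_comm]

theorem pair_eq_iff {a b x y : ℂ} (h : ({a, b} : Multiset ℂ) = {x, y}) :
    (a = x ∧ b = y) ∨ (a = y ∧ b = x) := by
  have h1 := congrArg Multiset.sum h
  have h2 := congrArg Multiset.prod h
  simp only [Multiset.insert_eq_cons, Multiset.sum_cons, Multiset.sum_singleton,
    Multiset.prod_cons, Multiset.prod_singleton] at h1 h2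
  grind

theorem exists_perm_of_triple_eq {f g : Fin 3 → ℂ}
    (h : ({f 0, f 1, f 2} : Multiset ℂ) = {g 0, g 1, g 2}) :
    ∃ σ : Equiv.Perm (Fin 3), ∀ i, f i = g (σ i) := by
  obtain ⟨j, hj⟩ : ∃ j, f 0 = g j := by
    have h0 : f 0 ∈ ({g 0, g 1, g 2} : Multiset ℂ) := h ▸ Multiset.mem_cons_self _ _
    simp only [Multiset.insert_eq_cons, Multiset.mem_cons, Multiset.mem_singleton] at h0
    rcases h0 with h0 | h0 | h0
    exacts [⟨0, h0⟩, ⟨1, h0⟩, ⟨2, h0⟩]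
  let τ : Equiv.Perm (Fin 3) := Equiv.swap 0 j
  have hτ : τ 0 = j := Equiv.swap_apply_left 0 j
  have hg : ({g 0, g 1, g 2} : Multiset ℂ) = {g (τ 0), g (τ 1), g (τ 2)} := by
    have : ∀ f : Fin 3 → ℂ, ({f 0, f 1, f 2} : Multiset ℂ) = Finset.univ.val.map f := fun f => rfl
    rw [this g, this fun i => g (τ i), ← Function.comp_def g τ, ← Multiset.map_map,
      Multiset.map_univ_val_equiv]
  rw [hg, hτ, ← hj] at h
  rcases pair_eq_iff ((Multiset.cons_inj_right _).1 h) with ⟨h1, h2⟩ | ⟨h1, h2⟩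
  · refine ⟨τ, fun i => ?_⟩
    fin_cases i
    exacts [hτ ▸ hj, h1, h2]
  · refine ⟨τ * Equiv.swap 1 2, fun i => ?_⟩
    fin_cases i
    exacts [hτ ▸ hj, h1, h2]

theorem Label.rightMat_apply_eq_zero (p : Label) (i j : Fin 3) (h : i < j) :
    p.rightMat i j = 0 := by
  cases p <;> fin_cases i <;> fin_cases j <;>
    first | (exact absurd h (by decide)) | simp [Label.rightMat, idx, table, v_apply]

theorem Label.leftMat_apply_eq_zero (p : Label) (i j : Fin 3) (h : i < j) :
    p.leftMat i j = 0 := by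
  cases p <;> fin_cases i <;> fin_cases j <;>
    first | (exact absurd h (by decide)) | simp [Label.leftMat, idx, table, v_apply]

/-- The diagonals of the triangular matrices of `R`, `S` and `R + S` are invariants, up to a common
factor and, for each of them, the order. -/
theorem DataEquiv.diagonal_eq {p q : Label} (h : DataEquiv p.R p.S p.w q.R q.S q.w) :
    ∃ c : ℂ, c ≠ 0 ∧
      ({table p .e₁ .x .e₁, table p .e₂ .x .e₂, table p .e₃ .x .e₃} : Multiset ℂ) =
        {c * table q .e₁ .x .e₁, c * table q .e₂ .x .e₂, c * table q .e₃ .x .e₃} ∧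
      ({table p .x .e₁ .e₁, table p .x .e₂ .e₂, table p .x .e₃ .e₃} : Multiset ℂ) =
        {c * table q .x .e₁ .e₁, c * table q .x .e₂ .e₂, c * table q .x .e₃ .e₃} ∧
      ({table p .e₁ .x .e₁ + table p .x .e₁ .e₁, table p .e₂ .x .e₂ + table p .x .e₂ .e₂,
          table p .e₃ .x .e₃ + table p .x .e₃ .e₃} : Multiset ℂ) =
        {c * (table q .e₁ .x .e₁ + table q .x .e₁ .e₁),
          c * (table q .e₂ .x .e₂ + table q .x .e₂ .e₂),
          c * (table q .e₃ .x .e₃ + table q .x .e₃ .e₃)} := by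
  obtain ⟨φ, c, n₀, hc, hR, hS, -⟩ := h
  refine ⟨c, hc, diagonal_eq_of_intertwine p.rightMat_apply_eq_zero q.rightMat_apply_eq_zero φ hR,
    diagonal_eq_of_intertwine p.leftMat_apply_eq_zero q.leftMat_apply_eq_zero φ hS,
    diagonal_eq_of_intertwine (A := p.rightMat + p.leftMat) (B := q.rightMat + q.leftMat)
      (fun i j hij => ?_) (fun i j hij => ?_) φ fun n => ?_⟩
  · rw [Matrix.add_apply, p.rightMat_apply_eq_zero i j hij, p.leftMat_apply_eq_zero i j hij,
      add_zero]
  · rw [Matrix.add_apply, q.rightMat_apply_eq_zero i j hij, q.leftMat_apply_eq_zero i j hij,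
      add_zero]
  · have h₁ := hR n
    have h₂ := hS n
    simp only [Label.R, Label.S] at h₁ h₂
    simp only [LinearMap.add_apply, map_add, h₁, h₂, smul_add]

/-! ### Separation of the families -/

theorem DataEquiv.symm_label {p q : Label} (h : DataEquiv p.R p.S p.w q.R q.S q.w) :
    DataEquiv q.R q.S q.w p.R p.S p.w :=
  (isomorphic_algebra_iff q p).1 ((isomorphic_algebra_iff p q).2 h).symm

/-- A polynomial with roots `1, 1, μ` determines `μ`, even up to a rescaling of the roots. -/
theorem eq_of_double_root {μ ν c : ℂ} (h1 : 2 + μ = c * (2 + ν))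
    (h2 : 1 + 2 * μ = c ^ 2 * (1 + 2 * ν)) (h3 : μ = c ^ 3 * ν) : μ = ν := by
  -- The two cubics are evaluated at the root `1`.
  have h : (1 - c) ^ 2 * (1 - c * ν) = 0 := by linear_combination h1 - h2 + h3
  have hc : (1 - c) ^ 2 = 0 := by
    rcases mul_eq_zero.1 h with h | h
    · exact h
    · linear_combination 2 * h1 - h2 - 2 * (1 - c) * h
  have hc : c = 1 := (sub_eq_zero.1 (eq_zero_of_pow_eq_zero hc)).symm
  rw [h3, hc, one_pow, one_mul]

/-- The Jordan type of the data and the solvability of `w = R n + S n`, as a function of the number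
of the family. -/
def jordanType (n : ℕ) : Bool × Bool × Bool × Bool × Bool :=
  (n ∉ [24, 25, 26, 30, 33, 36, 37, 39, 40], 29 ≤ n, 41 ≤ n, 35 ≤ n ∧ n ≤ 40, 27 ≤ n ∧ n ≤ 28)

theorem DataEquiv.jordanType_eq {p q : Label} (h : DataEquiv p.R p.S p.w q.R q.S q.w) :
    jordanType p.family = jordanType q.family := by
  have h' := h.symm_label
  have hW : SquareRemovable p.R p.S p.w ↔ SquareRemovable q.R q.S q.w :=
    ⟨h.squareRemovable, h'.squareRemovable⟩
  have hJ : HasJordanPair p.R ↔ HasJordanPair q.R := ⟨h.hasJordanPair, h'.hasJordanPair⟩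
  have hT : HasJordanTriple p.R ↔ HasJordanTriple q.R := ⟨h.hasJordanTriple, h'.hasJordanTriple⟩
  have hN : (∃ α, HasNilpotentPair p.R p.S α) ↔ ∃ α, HasNilpotentPair q.R q.S α :=
    ⟨fun ⟨α, hα⟩ => ⟨α, h.hasNilpotentPair hα⟩, fun ⟨α, hα⟩ => ⟨α, h'.hasNilpotentPair hα⟩⟩
  have hK : ActsOnKer p.R p.S ↔ ActsOnKer q.R q.S := ⟨h.actsOnKer, h'.actsOnKer⟩
  rw [p.squareRemovable_iff, q.squareRemovable_iff] at hW
  rw [p.hasJordanPair_iff, q.hasJordanPair_iff] at hJ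
  rw [p.hasJordanTriple_iff, q.hasJordanTriple_iff] at hT
  simp only [Label.hasNilpotentPair_iff, exists_and_left, exists_eq', and_true] at hN
  have hK' : (27 ≤ p.family ∧ p.family ≤ 28) ↔ 27 ≤ q.family ∧ q.family ≤ 28 := by
    by_cases hp : p.family ≤ 28
    · rw [Label.actsOnKer_iff hp, Label.actsOnKer_iff (by omega)] at hK
      omega
    · omega
  simp only [jordanType, hW, hJ, hT, hN, hK']

/-- Families of the same Jordan type are told apart by the eigenvalues of `S` and `R + S`, except
for 36 and 37 and for 39 and 40, which have different values of `α`. -/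
theorem DataEquiv.family_eq {p q : Label} (h : DataEquiv p.R p.S p.w q.R q.S q.w) :
    p.family = q.family := by
  have ht := h.jordanType_eq
  have hN : HasNilpotentPair q.R q.S (table p .x .e₁ .e₂) ↔ _ :=
    ⟨h.symm_label.hasNilpotentPair, h.hasNilpotentPair⟩
  rw [q.hasNilpotentPair_iff, p.hasNilpotentPair_iff] at hN
  obtain ⟨c, hc, -, hS, hA⟩ := h.symm_label.diagonal_eq
  obtain ⟨hS₁, hS₂, hS₃⟩ := triple_symm_eq hS
  obtain ⟨hA₁, hA₂, hA₃⟩ := triple_symm_eq hA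
  clear hS hA h
  cases p <;> cases q <;> simp only [Label.family] at ht <;> first
    | rfl
    | exact absurd ht (by decide)
    | (simp [table, v_apply, Label.family] at hN; done)
    | (clear hN ht
       simp [table, v_apply] at hS₁ hS₂ hS₃ hA₁ hA₂ hA₃ <;> grind)

/-- Within a family, the eigenvalues determine the parameters up to the stated coincidences, except
for the parameter `α` of the families 35 and 38. -/
theorem DataEquiv.sameUpToReordering {p q : Label}
    (h : DataEquiv p.R p.S p.w q.R q.S q.w) : p.SameUpToReordering q := by
  have hf := h.family_eq
  have hN := (h.hasNilpotentPair (α := table p .x .e₁ .e₂))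
  rw [q.hasNilpotentPair_iff, p.hasNilpotentPair_iff] at hN
  obtain ⟨c, hc, hR, hS, hA⟩ := h.symm_label.diagonal_eq
  obtain ⟨hR₁, hR₂, hR₃⟩ := triple_symm_eq hR
  obtain ⟨hS₁, hS₂, -⟩ := triple_symm_eq hS
  obtain ⟨hA₁, hA₂, -⟩ := triple_symm_eq hA
  clear h hS hA
  cases p <;> cases q <;> simp only [Label.family] at hf <;> first
    | rfl
    | exact absurd hf (by decide)
    | skip
  case L35.L35 | L38.L38 =>
    simp [table, v_apply, Label.family] at hN
    simp [Label.SameUpToReordering, hN]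
  all_goals simp [table, v_apply] at hR hR₁ hR₂ hR₃ hS₁ hS₂ hA₁ hA₂
  case L20.L20 | L23.L23 => exact ⟨c, hc, hR⟩
  case L21.L21 =>
    exact ⟨c, hc, pair_eq_of_add_of_mul (by linear_combination -hS₁) (by linear_combination hS₂),
      hA₁⟩
  case L22.L22 =>
    subst hS₁
    exact pair_eq_of_add_of_mul (by linear_combination hA₁) (by linear_combination hA₂)
  case L24.L24 | L26.L26 =>
    have h := pair_eq_iff (pair_eq_of_add_of_mul (a := 1) hR₁ (by linear_combination hR₂))
    simp only [Label.SameUpToReordering]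
    grind
  case L31.L31 | L32.L32 =>
    simp only [Label.SameUpToReordering, Label.L31.injEq, Label.L32.injEq]
    exact (eq_of_double_root (c := c) (by linear_combination hR₁) (by linear_combination hR₂)
      (by linear_combination hR₃)).symm
  all_goals
    simp only [Label.SameUpToReordering, Label.L25.injEq, Label.L29.injEq, Label.L34.injEq]
    grind

/-! ### Coincidences of parameters -/

/-- Algebras whose tables are diagonal agree when a permutation of `e₁, e₂, e₃`, a rescaling of the
`e`'s by `s` and one of `x` by `c` match their tables. -/
theorem dataEquiv_of_diagonal {p q : Label}
    (hpR : ∀ i j, i ≠ j → p.rightMat i j = 0) (hpS : ∀ i j, i ≠ j → p.leftMat i j = 0)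
    (hqR : ∀ i j, i ≠ j → q.rightMat i j = 0) (hqS : ∀ i j, i ≠ j → q.leftMat i j = 0)
    (σ : Equiv.Perm (Fin 3)) {s : Fin 3 → ℂ} (hs : ∀ i, s i ≠ 0) {c : ℂ} (hc : c ≠ 0)
    (hR : ∀ i, q.rightMat i i = c * p.rightMat (σ i) (σ i))
    (hS : ∀ i, q.leftMat i i = c * p.leftMat (σ i) (σ i))
    (hw : ∀ i, s i * q.w i = c ^ 2 * p.w (σ i)) : DataEquiv p.R p.S p.w q.R q.S q.w := by
  have hcol : ∀ {M : Matrix (Fin 3) (Fin 3) ℂ}, (∀ i j, i ≠ j → M i j = 0) → ∀ u i,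
      M.mulVecLin u i = M i i * u i := fun {M} hM u i => by
    rw [Matrix.mulVecLin_apply, Matrix.mulVec, dotProduct,
      Fintype.sum_eq_single i fun j hj => by rw [hM i j hj.symm, zero_mul]]
  let φ : (Fin 3 → ℂ) ≃ₗ[ℂ] (Fin 3 → ℂ) := LinearEquiv.ofLinearMap
    { toFun := fun u i => (s i)⁻¹ * u (σ i)
      map_add' := fun u v => funext fun i => mul_add _ _ _
      map_smul' := fun t u => funext fun i => mul_left_comm _ _ _ }
    { toFun := fun u i => s (σ.symm i) * u (σ.symm i)
      map_add' := fun u v => funext fun i => mul_add _ _ _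
      map_smul' := fun t u => funext fun i => mul_left_comm _ _ _ }
    (LinearMap.ext fun u => funext fun i => by simp [hs i])
    (LinearMap.ext fun u => funext fun i => by simp [hs])
  have hφ : ∀ u i, φ u i = (s i)⁻¹ * u (σ i) := fun u i => rfl
  refine ⟨φ, c⁻¹, 0, inv_ne_zero hc, fun n => funext fun i => ?_, fun n => funext fun i => ?_,
    funext fun i => ?_⟩
  · rw [hφ, Pi.smul_apply, smul_eq_mul, Label.R, Label.R, hcol hpR, hcol hqR, hφ, hR]
    field_simp
  · rw [hφ, Pi.smul_apply, smul_eq_mul, Label.S, Label.S, hcol hpS, hcol hqS, hφ, hS]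
    field_simp
  · rw [hφ, map_zero, map_zero, add_zero, smul_zero, add_zero, Pi.smul_apply, smul_eq_mul]
    have := hs i
    field_simp
    linear_combination -hw i

theorem Label.rightMat_offDiag {p : Label} (hp : p.family ≤ 26) (i j : Fin 3) (h : i ≠ j) :
    p.rightMat i j = 0 := by
  cases p <;> first
    | (exfalso; revert hp; simp [Label.family]; done)
    | (fin_cases i <;> fin_cases j <;> first
        | exact absurd rfl h
        | simp [Label.rightMat, idx, table, v_apply])

theorem Label.leftMat_offDiag {p : Label} (hp : p.family ≤ 26) (i j : Fin 3) (h : i ≠ j) :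
    p.leftMat i j = 0 := by
  cases p <;> first
    | (exfalso; revert hp; simp [Label.family]; done)
    | (fin_cases i <;> fin_cases j <;> first
        | exact absurd rfl h
        | simp [Label.leftMat, idx, table, v_apply])

theorem Label.SameUpToReordering.isomorphic {p q : Label} (h : p.SameUpToReordering q) :
    Isomorphic (algebra p) (algebra q) := by
  have hrefl : p = q → Isomorphic (algebra p) (algebra q) := by
    rintro rfl
    exact ⟨LinearEquiv.refl ℂ V, fun _ _ => rfl⟩
  have hdiag : p.family ≤ 26 → q.family ≤ 26 → ∀ (σ : Equiv.Perm (Fin 3)) {s : Fin 3 → ℂ}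
      (_ : ∀ i, s i ≠ 0) {c : ℂ} (_ : c ≠ 0)
      (_ : ∀ i, q.rightMat i i = c * p.rightMat (σ i) (σ i))
      (_ : ∀ i, q.leftMat i i = c * p.leftMat (σ i) (σ i))
      (_ : ∀ i, s i * q.w i = c ^ 2 * p.w (σ i)), Isomorphic (algebra p) (algebra q) :=
    fun hp hq σ s hs c hc hR hS hw => (isomorphic_algebra_iff p q).2
      (dataEquiv_of_diagonal (Label.rightMat_offDiag hp) (Label.leftMat_offDiag hp)
        (Label.rightMat_offDiag hq) (Label.leftMat_offDiag hq) σ hs hc hR hS hw)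
  cases p <;> cases q <;> try exact hrefl h
  case L20.L20 μ₂ μ₃ ν₂ ν₃ =>
    obtain ⟨c, hc, h⟩ := h
    obtain ⟨σ, hσ⟩ := exists_perm_of_triple_eq (f := ![1, ν₂, ν₃]) (g := ![c, c * μ₂, c * μ₃]) h
    have hd : ∀ i, (Label.L20 ν₂ ν₃).rightMat i i = c * (Label.L20 μ₂ μ₃).rightMat (σ i) (σ i) := by
      intro i
      have hq : (Label.L20 ν₂ ν₃).rightMat i i = ![1, ν₂, ν₃] i := by
        fin_cases i <;> simp [Label.rightMat, idx, table, v_apply]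
      rw [hq, hσ i]
      generalize σ i = j
      fin_cases j <;> simp [Label.rightMat, idx, table, v_apply]
    have hS : ∀ (μ₂ μ₃ : ℂ) (i : Fin 3),
        (Label.L20 μ₂ μ₃).leftMat i i = -(Label.L20 μ₂ μ₃).rightMat i i := by
      intro μ₂ μ₃ i
      fin_cases i <;> simp [Label.rightMat, Label.leftMat, idx, table, v_apply]
    refine hdiag (by simp [Label.family]) (by simp [Label.family]) σ (s := 1) (by simp) hc hd
      (fun i => ?_) (fun i => ?_)
    · rw [hS, hS, hd, mul_neg]
    · simp [Label.w, table]
  case L23.L23 μ₂ μ₃ ν₂ ν₃ =>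
    obtain ⟨c, hc, h⟩ := h
    obtain ⟨σ, hσ⟩ := exists_perm_of_triple_eq (f := ![1, ν₂, ν₃]) (g := ![c, c * μ₂, c * μ₃]) h
    refine hdiag (by simp [Label.family]) (by simp [Label.family]) σ (s := 1) (by simp) hc
      (fun i => ?_) (fun i => ?_) (fun i => ?_)
    · have hq : (Label.L23 ν₂ ν₃).rightMat i i = ![1, ν₂, ν₃] i := by
        fin_cases i <;> simp [Label.rightMat, idx, table, v_apply]
      rw [hq, hσ i]
      generalize σ i = j
      fin_cases j <;> simp [Label.rightMat, idx, table, v_apply]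
    · simp [Label.leftMat, table]
    · simp [Label.w, table]
  case L21.L21 μ₂ μ₃ h₃ ν₂ ν₃ h₃' =>
    obtain ⟨c, hc, h, rfl⟩ := h
    obtain ⟨h₁, h₂⟩ | ⟨h₁, h₂⟩ := pair_eq_iff h
    · subst h₁
      refine hrefl ?_
      simp [h₂]
    · refine hdiag (by simp [Label.family]) (by simp [Label.family]) (Equiv.swap 0 1) (s := 1)
        (by simp) hc (fun i => ?_) (fun i => ?_) (fun i => ?_) <;>
      fin_cases i <;>
        simp [Label.rightMat, Label.leftMat, Label.w, idx, table, v_apply, h₂, ← h₁,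
          Equiv.swap_apply_def]
  case L22.L22 μ₂ μ₃ h₂ h₃ ν₂ ν₃ h₂' h₃' =>
    obtain ⟨rfl, rfl⟩ | ⟨rfl, rfl⟩ := pair_eq_iff h
    · exact hrefl rfl
    · refine hdiag (by simp [Label.family]) (by simp [Label.family]) (Equiv.swap 1 2) (s := 1)
        (by simp) one_ne_zero (fun i => ?_) (fun i => ?_) (fun i => ?_) <;>
      fin_cases i <;>
        simp [Label.rightMat, Label.leftMat, Label.w, idx, table, v_apply, Equiv.swap_apply_def]
  case L24.L24 μ₂ ν₂ | L26.L26 μ₂ ν₂ =>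
    obtain rfl | h := h
    · exact hrefl rfl
    · -- Exchanging `e₁` and `e₂` requires `x ↦ ν₂ x`, and so `[x, x] = e₃` is multiplied by `ν₂²`.
      have hν : ν₂ ≠ 0 := right_ne_zero_of_mul_eq_one h
      rw [mul_comm] at h
      refine hdiag (by simp [Label.family]) (by simp [Label.family]) (Equiv.swap 0 1)
        (s := fun _ => ν₂ ^ 2) (by simp [hν]) hν (fun i => ?_) (fun i => ?_) (fun i => ?_) <;>
      fin_cases i <;>
        simp [Label.rightMat, Label.leftMat, Label.w, idx, table, v_apply, h,
          Equiv.swap_apply_def]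

end LeibnizClassification

theorem mainTheorem1 :
    -- every algebra in question is isomorphic to an algebra of the list, in exactly one family
    (∀ (L : Type*) [AddCommGroup L] [Module ℂ L] (b : L →ₗ[ℂ] L →ₗ[ℂ] L),
      IsSolvableWithAbelianNilradical b →
        ∃! n : ℕ, ∃ p : Label, p.family = n ∧ Isomorphic b (algebra p)) ∧
    -- every algebra of the list is one of the algebras in question
    (∀ p : Label, IsSolvableWithAbelianNilradical (algebra p)) ∧
    -- the algebras of the list are pairwise non-isomorphic, up to a reordering of parameters
    (∀ p q : Label, Isomorphic (algebra p) (algebra q) ↔ p.SameUpToReordering q) := by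
  refine ⟨fun L _ _ b hb => ?_, fun p => p.isSolvableWithAbelianNilradical, fun p q =>
    ⟨fun h => ((isomorphic_algebra_iff p q).1 h).sameUpToReordering, fun h => h.isomorphic⟩⟩
  obtain ⟨p, hp⟩ := hb.exists_label
  refine ⟨p.family, ⟨p, rfl, hp⟩, ?_⟩
  rintro - ⟨q, rfl, hq⟩
  exact ((isomorphic_algebra_iff q p).1 (hq.symm.trans hp)).family_eq
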